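/- Let $A=\mathbb F_q[T]$, $K=\mathbb F_q(T)$, let $K_\infty$ be the completion of $K$ at $\infty=1/T$ (with $|T|=q$), $\mathbb C_\infty$ the completion of an algebraic closure of $K_\infty$, $\Omega=\mathbb C_\infty\setminus K_\infty$, and let $\mathcal O$ be the set of rigid analytic functions $\Omega\to\mathbb C_\infty$ that are $I$-periodic for some nonzero ideal $I$ of $A$. For $\gamma=\begin{pmatrix}a&b\\c&d\end{pmatrix}\in \mathrm{GL}_2(K)$ put $(f|_{k,m}\gamma)(z)=(\det\gamma)^m(cz+d)^{-k}f(\gamma z)$. Let $\Gamma\subset\mathrm{GL}_2(K)$ be a subgroup that is commensurable with $\mathrm{GL}_2(A)$ and contains $\Gamma(\mathfrak m)=\ker(\mathrm{GL}_2(A)\to\mathrm{GL}_2(A/\mathfrak m))$ for some nonzero ideal $\mathfrak m$ of $A$. A rigid analytic $f:\Omega\to\mathbb C_\infty$ is a Drinfeld quasi-modular form of weight $k$, type $m$ and depth at most $\ell$ for $\Gamma$, written $f\in\widetilde M^{\leqslant\ell}_{k,m}(\Gamma)$, if there is a polynomial $P_f=\sum_{i=0}^{\ell}f_iX^i\in\mathcal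 O[X]$, called the associated polynomial of $f$, such that $$(f|_{k,m}\gamma)(z)=\sum_{i=0}^{\ell}f_i(z)\Bigl(\frac{c}{cz+d}\Bigr)^i\qquad\text{for all }\gamma\in\Gamma,\ z\in\Omega,$$ and such that, for all $i$ and all $\gamma\in\mathrm{GL}_2(K)$, $|(f_i|_{k-2i,m-i}\gamma)(z)|$ is bounded as $\inf_{x\in K_\infty}|z-x|\to\infty$. Let $M_{k,m}(\Gamma)=\widetilde M^{\leqslant 0}_{k,m}(\Gamma)$ be the space of Drinfeld modular forms. Let $\tilde\pi$ be a period of the Carlitz module (a generator of the $A$-module of zeros of the Carlitz exponential), let $$E(z)=\tilde\pi^{-1}\sum_{a\in A\text{ monic}}\ \sum_{b\in A}\frac{a}{az+b}$$ be the false Eisenstein series, and let $D_n=(-\tilde\pi)^{-n}\mathcal D_n$, where the hyperderivatives $\mathcal D_n$ are defined by $f(z+\varepsilon)=\sum_{n\ge0}(\mathcal D_nf)(z)\varepsilon^n$ for small $\varepsilon$. **Theorem.** Let $\ell\ge1$ and $f\in\widetilde M^{\leqslant\ell}_{k,m}(\Gamma)$. (1) If $k>2\ell$ and $f=\sum_{i=0}^{\ell}D_if_{i,D}$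 with $f_{i,D}\in M_{k-2i,m-i}(\Gamma)$ for $0\le i\le\ell$, then the associated polynomial of $f$ is (uniquely) $P_f=\sum_{j=0}^{\ell}f_jX^j$ with $$f_j=(-\tilde\pi)^{-j}\sum_{h=j}^{\ell}\binom{k-h-1}{j}D_{h-j}f_{h,D}\qquad(0\le j\le\ell).$$ (2) If $k=2\ell$ and $f=\alpha_fD_{\ell-1}E+\sum_{i=0}^{\ell-1}D_if_{i,D}$ with $\alpha_f\in\mathbb C_\infty$ and $f_{i,D}\in M_{k-2i,m-i}(\Gamma)$ for $0\le i\le\ell-1$, then the associated polynomial of $f$ is (uniquely) $P_f=\sum_{j=0}^{\ell}f_jX^j$ with $f_\ell=\alpha_f(-\tilde\pi)^{-\ell}$ and $$f_j=(-\tilde\pi)^{-j}\Bigl[\alpha_f\binom{\ell}{j}D_{\ell-j-1}E+\sum_{h=j}^{\ell-1}\binom{2\ell-h-1}{j}D_{h-j}f_{h,D}\Bigr]\qquad(0\le j\le\ell-1).$$ -/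

import Mathlib

open Filter Topology Polynomial
open scoped NNReal

noncomputable section

namespace Drinfeld

/-! ### The fields `A ⊆ K ⊆ K_∞ ⊆ ℂ_∞` -/

section Fields

variable (F : Type*) [Field F]

/-- `A = 𝔽_q[T]`, for the finite field `F = 𝔽_q`. -/
abbrev A := Polynomial F

/-- `K = 𝔽_q(T)`. -/
abbrev K := RatFunc F

open scoped Classical in
/-- `K_∞`, the completion of `K` at the place `∞ = 1/T`. -/
abbrev KInf := RatFunc.CompletionAtInfty F

variable [Finite F]

theorem one_lt_card : (1 : ℝ≥0) < (Nat.card F : ℝ≥0) := by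
  exact_mod_cast Finite.one_lt_card

/-- The valuation on `K_∞` is normalised so that `|T|_∞ = q`. -/
instance rankOneKInf : (Valued.v : Valuation (KInf F) (WithZero (Multiplicative ℤ))).RankOne where
  hom' := (WithZeroMulInt.toNNReal (one_lt_card F).ne_zero).comp
    MonoidWithZeroHom.ValueGroup₀.embedding
  strictMono' := (WithZeroMulInt.toNNReal_strictMono (one_lt_card F)).comp
    MonoidWithZeroHom.ValueGroup₀.embedding_strictMono
  exists_val_nontrivial := by
    classical
    refine ⟨algebraMap (RatFunc F) (KInf F) RatFunc.X, ?_⟩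
    have h : Valued.v (algebraMap (RatFunc F) (KInf F) RatFunc.X) =
        WithZero.exp (1 : ℤ) := by
      let _ := RatFunc.inftyValued F
      exact (RatFunc.valuedCompletionAtInfty.def F).trans
        ((Valued.extensionValuation_apply_coe (K := RatFunc F) RatFunc.X).trans
          (RatFunc.inftyValuation.X F))
    rw [h]
    exact ⟨WithZero.exp_ne_zero, by simp [← WithZero.exp_zero]⟩

/-- The `∞`-adic absolute value on `K_∞`. -/
instance : NontriviallyNormedField (KInf F) :=
  Valued.toNontriviallyNormedField (KInf F) (WithZero (Multiplicative ℤ))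

instance : IsUltrametricDist (KInf F) := by
  infer_instance

instance : CompleteSpace (KInf F) := by
  classical
  let _ := RatFunc.inftyValued F
  exact inferInstanceAs (CompleteSpace (UniformSpace.Completion (RatFunc F)))

/-- An algebraic closure of `K_∞`, with the unique extension of the absolute value. -/
abbrev KInfAlg := AlgebraicClosure (KInf F)

instance : NontriviallyNormedField (KInfAlg F) :=
  spectralNorm.nontriviallyNormedField (KInf F) (KInfAlg F)

instance : NormedAlgebra (KInf F) (KInfAlg F) := spectralNorm.normedAlgebra _ _

/-- `ℂ_∞`, the completion of an algebraic closure of `K_∞`. -/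
abbrev CInf := UniformSpace.Completion (KInfAlg F)

/-- The absolute value of `ℂ_∞`, extending that of `K_∞`. -/
instance : NontriviallyNormedField (CInf F) where
  toNormedField := inferInstance
  non_trivial := by
    obtain ⟨x, hx⟩ := NontriviallyNormedField.non_trivial (α := KInf F)
    exact ⟨algebraMap (KInf F) (CInf F) x, by simpa using hx⟩

end Fields

variable {F : Type*} [Field F] [Finite F]

/-- The embedding `K → ℂ_∞`. -/
def ofK : K F →+* CInf F :=
  (algebraMap (KInf F) (CInf F)).comp (algebraMap (K F) (KInf F))

/-- The embedding `A → ℂ_∞`. -/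
def ofA : A F →+* CInf F := ofK.comp (algebraMap (A F) (K F))

/-! ### The Drinfeld upper half-plane and the action of `GL₂(K)` -/

variable (F) in
/-- The Drinfeld upper half-plane `Ω = ℙ¹(ℂ_∞) - ℙ¹(K_∞) = ℂ_∞ - K_∞`. -/
abbrev Omega := {z : CInf F // z ∉ Set.range (algebraMap (KInf F) (CInf F))}

/-- `cz + d` for `γ = (a b; c d)`. -/
def den (γ : GL (Fin 2) (K F)) (z : Omega F) : CInf F := ofK (γ 1 0) * z + ofK (γ 1 1)

/-- `az + b` for `γ = (a b; c d)`. -/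
def num (γ : GL (Fin 2) (K F)) (z : Omega F) : CInf F := ofK (γ 0 0) * z + ofK (γ 0 1)

theorem eq_zero_of_mul_add_eq_zero {u v : KInf F} (z : Omega F)
    (h : algebraMap (KInf F) (CInf F) u * z + algebraMap (KInf F) (CInf F) v = 0) :
    u = 0 ∧ v = 0 := by
  have hu : u = 0 := by
    by_contra hu
    have hu' : algebraMap (KInf F) (CInf F) u ≠ 0 := by simpa using hu
    refine z.2 ⟨-v / u, ?_⟩
    rw [map_div₀, map_neg]
    field_simp
    linear_combination -h
  subst hu
  simpa using h

theorem det_ne_zero {F : Type*} [Field F] (γ : GL (Fin 2) (K F)) :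
    γ 0 0 * γ 1 1 - γ 0 1 * γ 1 0 ≠ 0 := by
  have h := γ.det.ne_zero
  rwa [Matrix.GeneralLinearGroup.val_det_apply, Matrix.det_fin_two] at h

theorem den_ne_zero (γ : GL (Fin 2) (K F)) (z : Omega F) : den γ z ≠ 0 := by
  intro h
  obtain ⟨hc, hd⟩ := eq_zero_of_mul_add_eq_zero z h
  have hc' : γ 1 0 = 0 := by simpa using hc
  have hd' : γ 1 1 = 0 := by simpa using hd
  exact det_ne_zero γ (by simp [hc', hd'])

theorem num_div_den_mem (γ : GL (Fin 2) (K F)) (z : Omega F) :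
    num γ z / den γ z ∉ Set.range (algebraMap (KInf F) (CInf F)) := by
  rintro ⟨x, hx⟩
  rw [eq_div_iff (den_ne_zero γ z)] at hx
  have h : algebraMap (KInf F) (CInf F)
        (algebraMap (K F) (KInf F) (γ 0 0) - x * algebraMap (K F) (KInf F) (γ 1 0)) * z +
      algebraMap (KInf F) (CInf F)
        (algebraMap (K F) (KInf F) (γ 0 1) - x * algebraMap (K F) (KInf F) (γ 1 1)) = 0 := by
    simp only [num, den, ofK, RingHom.comp_apply] at hx
    simp only [map_sub, map_mul]
    linear_combination -hx
  obtain ⟨h1, h2⟩ := eq_zero_of_mul_add_eq_zero z h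
  apply det_ne_zero γ
  apply (algebraMap (K F) (KInf F)).injective
  simp only [map_sub, map_mul, map_zero]
  linear_combination (algebraMap (K F) (KInf F) (γ 1 1)) * h1 -
    (algebraMap (K F) (KInf F) (γ 1 0)) * h2

/-- The fractional linear transformation `γ z = (az + b) / (cz + d)` of `Ω`. -/
def moebius (γ : GL (Fin 2) (K F)) (z : Omega F) : Omega F :=
  ⟨num γ z / den γ z, num_div_den_mem γ z⟩

/-- The slash operator `(f |_{k,m} γ)(z) = (det γ)^m (cz + d)^{-k} f(γ z)`. -/
def slash (k m : ℤ) (f : Omega F → CInf F) (γ : GL (Fin 2) (K F)) : Omega F → CInf F :=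
  fun z => ofK (γ.det : K F) ^ m * den γ z ^ (-k) * f (moebius γ z)

/-! ### Arithmetic subgroups of congruence type -/

variable (F) in
/-- `GL₂(A)`, as a subgroup of `GL₂(K)`. -/
def GL2A : Subgroup (GL (Fin 2) (K F)) :=
  (Matrix.GeneralLinearGroup.map (algebraMap (A F) (K F))).range

/-- `Γ(𝔪)`, the matrices in `GL₂(A)` congruent to the identity modulo `𝔪`,
as a subgroup of `GL₂(K)`. -/
def principal (𝔪 : Ideal (A F)) : Subgroup (GL (Fin 2) (K F)) :=
  (Matrix.GeneralLinearGroup.map (n := Fin 2) (Ideal.Quotient.mk 𝔪)).ker.map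
    (Matrix.GeneralLinearGroup.map (algebraMap (A F) (K F)))

/-- `Γ` is an arithmetic subgroup of congruence type: it is commensurable with `GL₂(A)` and
contains `Γ(𝔪)` for some nonzero ideal `𝔪` of `A`. -/
def IsCongruence (Γ : Subgroup (GL (Fin 2) (K F))) : Prop :=
  Γ.Commensurable (GL2A F) ∧ ∃ 𝔪 : Ideal (A F), 𝔪 ≠ ⊥ ∧ principal 𝔪 ≤ Γ

/-! ### Rigid analytic functions -/

variable (F) in
/-- The standard affinoid
`Ω_n = {z : |z| ≤ q^n and |z - x| ≥ q^{-n} for all x ∈ K_∞}`. The `Ω_n` for `n ∈ ℕ` form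
an admissible covering of `Ω`. -/
def affinoid (n : ℕ) : Set (Omega F) :=
  {z | ‖(z : CInf F)‖ ≤ (Nat.card F : ℝ) ^ n ∧
    ∀ x : KInf F, ((Nat.card F : ℝ) ^ n)⁻¹ ≤ ‖(z : CInf F) - algebraMap (KInf F) (CInf F) x‖}

/-- `f` is rigid analytic on `Ω`: on each affinoid `Ω_n` it is a uniform limit of rational
functions without poles on `Ω_n`. -/
def IsRigidAnalytic (f : Omega F → CInf F) : Prop :=
  ∀ n : ℕ, ∀ ε : ℝ, 0 < ε → ∃ P Q : (CInf F)[X], ∀ z ∈ affinoid F n,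
    Q.eval (z : CInf F) ≠ 0 ∧ ‖f z - P.eval (z : CInf F) / Q.eval (z : CInf F)‖ ≤ ε

/-- The set `𝒪` of rigid analytic functions on `Ω` that are `I`-periodic for some nonzero
ideal `I` of `A`. -/
def MemO (f : Omega F → CInf F) : Prop :=
  IsRigidAnalytic f ∧ ∃ I : Ideal (A F), I ≠ ⊥ ∧
    ∀ a ∈ I, ∀ z w : Omega F, (w : CInf F) = z + ofA a → f w = f z

/-! ### Quasi-modular forms and associated polynomials -/

/-- `P = ∑ f_i X^i ∈ 𝒪[X]` is the associated polynomial of `f` (in weight `k` and type `m`,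
for `Γ`): for all `γ = (a b; c d) ∈ Γ` and all `z`,
`(f |_{k,m} γ)(z) = ∑ f_i(z) (c / (cz + d))^i`. -/
def IsAssocPoly (Γ : Subgroup (GL (Fin 2) (K F))) (k m : ℤ) (f : Omega F → CInf F)
    (P : (Omega F → CInf F)[X]) : Prop :=
  (∀ i, MemO (P.coeff i)) ∧
  ∀ γ ∈ Γ, ∀ z : Omega F, slash k m f γ z =
    ∑ i ∈ Finset.range (P.natDegree + 1), P.coeff i z * (ofK (γ 1 0) / den γ z) ^ i

/-- The imaginary absolute value `|z|_i = inf {|z - x| : x ∈ K_∞}`. -/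
def imAbs (z : Omega F) : ℝ :=
  ⨅ x : KInf F, ‖(z : CInf F) - algebraMap (KInf F) (CInf F) x‖

/-- `f` is bounded on vertical lines: `|f(z)|` is bounded as `|z|_i → ∞`. -/
def BoundedOnVerticalLines (f : Omega F → CInf F) : Prop :=
  ∃ N B : ℝ, ∀ z : Omega F, N ≤ imAbs z → ‖f z‖ ≤ B

/-- `f` is a Drinfeld quasi-modular form of weight `k`, type `m` and depth at most `ℓ`
for `Γ`. -/
def IsQuasiModularForm (Γ : Subgroup (GL (Fin 2) (K F))) (k m : ℤ) (ℓ : ℕ)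
    (f : Omega F → CInf F) : Prop :=
  IsRigidAnalytic f ∧ ∃ P : (Omega F → CInf F)[X], P.natDegree ≤ ℓ ∧ IsAssocPoly Γ k m f P ∧
    ∀ (i : ℕ) (γ : GL (Fin 2) (K F)),
      BoundedOnVerticalLines (slash (k - 2 * i) (m - i) (P.coeff i) γ)

/-- `f` is a Drinfeld modular form of weight `k` and type `m` for `Γ`. -/
def IsModularForm (Γ : Subgroup (GL (Fin 2) (K F))) (k m : ℤ) (f : Omega F → CInf F) : Prop :=
  IsQuasiModularForm Γ k m 0 f

/-! ### Hyperderivatives -/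

open scoped Classical in
/-- The hyperderivative `𝒟_n f`, determined by `f(z + ε) = ∑ (𝒟_n f)(z) ε^n` for all small `ε`.
(At points where `f` has no such expansion, which do not exist for rigid analytic `f`, the value
is `0`.) -/
def hyperDeriv (n : ℕ) (f : Omega F → CInf F) (z : Omega F) : CInf F :=
  if h : ∃ a : ℕ → CInf F, ∀ᶠ ε in 𝓝 (0 : CInf F),
      ∃ hε : (z : CInf F) + ε ∉ Set.range (algebraMap (KInf F) (CInf F)),
        HasSum (fun i => a i * ε ^ i) (f ⟨z + ε, hε⟩)
  then h.choose n else 0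

/-- The normalised hyperderivative `D_n = (-π̃)^{-n} 𝒟_n`. -/
def normDeriv (π : CInf F) (n : ℕ) (f : Omega F → CInf F) : Omega F → CInf F :=
  ((-π) ^ n)⁻¹ • hyperDeriv n f

/-! ### The Carlitz period and the false Eisenstein series -/

variable (F) in
/-- `D_i = ∏_{j < i} (T^{q^i} - T^{q^j})`. -/
def carlitzD (i : ℕ) : A F :=
  ∏ j ∈ Finset.range i, (X ^ Nat.card F ^ i - X ^ Nat.card F ^ j)

/-- The exponential function `z ↦ ∑ z^{q^i} / D_i` of the Carlitz module. -/
def carlitzExp (z : CInf F) : CInf F :=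
  ∑' i : ℕ, z ^ Nat.card F ^ i / ofA (carlitzD F i)

/-- `π` is a period `π̃` of the Carlitz module: a generator of the `A`-lattice of zeros of the
Carlitz exponential. -/
def IsCarlitzPeriod (π : CInf F) : Prop :=
  π ≠ 0 ∧ ∀ z : CInf F, carlitzExp z = 0 ↔ ∃ a : A F, z = ofA a * π

/-- The false Eisenstein series `E(z) = π̃⁻¹ ∑_{a monic} ∑_b a / (az + b)`. -/
def falseE (π : CInf F) (z : Omega F) : CInf F :=
  π⁻¹ * ∑' a : {a : A F // a.Monic}, ∑' b : A F, ofA a.1 / (ofA a.1 * z + ofA b)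

end Drinfeld

end

/-
A rigid analytic function on `Ω` is a locally uniform limit of polynomials, so it has convergent
expansions, whose coefficients are its hyperderivatives. If `g` is modular of weight `k` and
`t = c / (cz + d)`, comparing the expansion of `g` at `z` with that at `γz`, under the substitution
`ε ↦ ε / (1 - tε)` up to a scalar, expresses `(D_n g) | γ` as a polynomial in `t` whose
coefficients are multiples of the `D_j g` by binomial coefficients. The same computation applies to
`D_n E`, once `E | γ - E` is known to be a multiple of `t`: `γ = (1 0; c 1)` permutes large boxes of
pairs `(a, b)`, each term with `(a, b) ≠ 0` picks up the same constant, and the number of these,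
`q ^ N - 1`, is `-1` in `ℂ_∞`. Hence the given decomposition of `f` yields one polynomial in `t`
representing `f | γ`, and the associated polynomial is another. They agree at `c / (cz + 1)` for
infinitely many `c`, as `Γ` contains a congruence subgroup, and therefore coincide.
-/

noncomputable section

namespace Drinfeld

section AlgebraicClosedness

variable {K L : Type*} [Field K] [IsAlgClosed K] [NontriviallyNormedField L] [Algebra K L]

theorem mem_closure_range_of_aeval_eq_zero (hK : DenseRange (algebraMap K L))
    {E : Type*} [NormedField E] [NormedAlgebra L E] {f : L[X]} (hf : f.Monic) {a : E}
    (ha : aeval a f = 0) : a ∈ closure (Set.range (algebraMap L E)) := by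
  rw [Metric.mem_closure_range_iff]
  intro δ hδ
  have hdeg : (f.natDegree : ℝ)⁻¹ ≠ 0 := by
    simpa using (hf.natDegree_pos_of_not_isUnit fun h => by
      simp [hf.eq_one_of_isUnit h] at ha).ne'
  have hsmall : Tendsto
      (fun ε : ℝ => ((f.natDegree + 1) * ε) ^ (f.natDegree : ℝ)⁻¹ * max ‖a‖ 1) (𝓝[>] 0) (𝓝 0) := by
    refine Tendsto.mono_left ?_ nhdsWithin_le_nhds
    have h := (((continuous_const_mul ((f.natDegree : ℝ) + 1)).rpow_const (p := (f.natDegree : ℝ)⁻¹)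
      fun _ => Or.inr (by positivity)).mul_const (max ‖a‖ 1)).tendsto 0
    simpa [Real.zero_rpow hdeg] using h
  obtain ⟨ε, hεδ, hε⟩ := ((hsmall.eventually_lt_const hδ).and self_mem_nhdsWithin).exists
  obtain ⟨g, hg, hgf, hcoeff⟩ :=
    exists_monic_and_natDegree_eq_and_norm_map_algebraMap_coeff_sub_lt hK hf hε
  have hsplits := (IsAlgClosed.splits g).map (algebraMap K L)
  obtain ⟨b, hb, hab⟩ := exists_aroots_norm_sub_lt_of_norm_coeff_sub_lt hε ha hf (hg.map _)
    ((natDegree_map _).trans hgf.symm) hcoeff (hsplits.map _)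
  rw [aroots_def, hsplits.roots_map, Multiset.mem_map] at hb
  obtain ⟨c, -, rfl⟩ := hb
  exact ⟨c, (dist_eq_norm a _).trans_lt (hab.trans hεδ)⟩

theorem isAlgClosed_of_denseRange [CompleteSpace L] [IsUltrametricDist L]
    (hK : DenseRange (algebraMap K L)) : IsAlgClosed L := by
  refine IsAlgClosed.of_exists_root L fun f hf hirr => ?_
  let E := AlgebraicClosure L
  let _ : NormedField E := spectralNorm.normedField L E
  let _ : NormedAlgebra L E := spectralNorm.normedAlgebra L E
  obtain ⟨a, ha⟩ := IsAlgClosed.exists_aeval_eq_zero E f hirr.degree_pos.ne'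
  have hclosed : IsClosed (Set.range (algebraMap L E)) :=
    (algebraMap_isometry L E).isClosedEmbedding.isClosed_range
  obtain ⟨b, rfl⟩ := hclosed.closure_subset (mem_closure_range_of_aeval_eq_zero hK hf ha)
  exact ⟨b, by simpa using ha⟩

end AlgebraicClosedness

theorem norm_sub_le_max {G : Type*} [SeminormedAddGroup G] [IsUltrametricDist G] (x y : G) :
    ‖x - y‖ ≤ max ‖x‖ ‖y‖ := by
  simpa only [sub_eq_add_neg, norm_neg] using IsUltrametricDist.norm_add_le_max x (-y)

section PolynomialLimit

open Finset in
theorem sum_pow_mul_eval_primitiveRoot {R : Type*} [CommRing R] [IsDomain R] {N : ℕ} {ζ : R}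
    (hζ : IsPrimitiveRoot ζ N) {P : R[X]} (hP : P.natDegree < N) {n : ℕ} (hn : n < N) :
    ∑ k ∈ range N, (ζ ^ k) ^ (N - n) * P.eval (ζ ^ k) = N * P.coeff n := by
  have hsum (j : ℕ) : ∑ k ∈ range N, (ζ ^ j) ^ k = if N ∣ j then (N : R) else 0 := by
    split_ifs with hj
    · simp [(hζ.pow_eq_one_iff_dvd j).2 hj]
    · have hmul := mul_neg_geom_sum (ζ ^ j) N
      rw [pow_right_comm, hζ.pow_eq_one, one_pow, sub_self] at hmul
      exact (mul_eq_zero.1 hmul).resolve_left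
        (sub_ne_zero.2 fun h => hj ((hζ.pow_eq_one_iff_dvd j).1 h.symm))
  calc ∑ k ∈ range N, (ζ ^ k) ^ (N - n) * P.eval (ζ ^ k)
      = ∑ j ∈ range N, P.coeff j * ∑ k ∈ range N, (ζ ^ (N - n + j)) ^ k := by
        simp only [eval_eq_sum_range' hP, mul_sum]
        rw [sum_comm]
        refine sum_congr rfl fun j _ => sum_congr rfl fun k _ => ?_
        ring
    _ = P.coeff n * N := by
        rw [sum_eq_single_of_mem n (mem_range.2 hn), hsum, if_pos (by simp [hn.le])]
        intro j hj hjn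
        have hndvd : ¬ N ∣ N - n + j := by
          rintro ⟨_ | _ | d, hd⟩
          · lia
          · lia
          · have := mem_range.1 hj
            nlinarith [Nat.sub_le N n]
        rw [hsum, if_neg hndvd, mul_zero]
    _ = N * P.coeff n := mul_comm _ _

variable {𝕜 : Type*} [NontriviallyNormedField 𝕜] [IsUltrametricDist 𝕜]

theorem norm_natCast_eq_one_or_succ (N : ℕ) : ‖(N : 𝕜)‖ = 1 ∨ ‖((N + 1 : ℕ) : 𝕜)‖ = 1 := by
  by_contra! h
  have hN := (IsUltrametricDist.norm_natCast_le_one 𝕜 N).lt_of_ne h.1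
  have hN' := (IsUltrametricDist.norm_natCast_le_one 𝕜 (N + 1)).lt_of_ne h.2
  have := (norm_sub_le_max ((N + 1 : ℕ) : 𝕜) N).trans_lt (max_lt hN' hN)
  simp at this

-- A coefficient is an average of values at `N`-th roots of unity, where `N` has absolute value `1`.
theorem norm_coeff_le [IsAlgClosed 𝕜] {P : 𝕜[X]} {M : ℝ}
    (hM : ∀ x, ‖x‖ ≤ 1 → ‖P.eval x‖ ≤ M) (n : ℕ) : ‖P.coeff n‖ ≤ M := by
  obtain ⟨N, hPN, hnN, hN⟩ : ∃ N : ℕ, P.natDegree < N ∧ n < N ∧ ‖(N : 𝕜)‖ = 1 := by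
    rcases norm_natCast_eq_one_or_succ (𝕜 := 𝕜) (P.natDegree + n + 1) with h | h
    exacts [⟨_, by lia, by lia, h⟩, ⟨_, by lia, by lia, h⟩]
  have : NeZero (N : 𝕜) := ⟨norm_ne_zero_iff.1 (hN ▸ one_ne_zero)⟩
  have : NeZero N := ⟨by lia⟩
  obtain ⟨ζ, hζ⟩ := HasEnoughRootsOfUnity.exists_primitiveRoot 𝕜 N
  have hζ1 : ‖ζ‖ = 1 := (hζ.isOfFinOrder (NeZero.ne N)).norm_eq_one
  calc ‖P.coeff n‖ = ‖N * P.coeff n‖ := by rw [norm_mul, hN, one_mul]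
    _ = ‖∑ k ∈ Finset.range N, (ζ ^ k) ^ (N - n) * P.eval (ζ ^ k)‖ := by
        rw [sum_pow_mul_eval_primitiveRoot hζ hPN hnN]
    _ ≤ M := by
        refine IsUltrametricDist.norm_sum_le_of_forall_le_of_nonneg
          ((norm_nonneg _).trans (hM 0 (by simp))) fun k _ => ?_
        simpa [hζ1] using hM (ζ ^ k) (by simp [hζ1])

/-- `f` is a uniform limit of polynomials on the closed unit ball, that is, an element of the Tate
algebra in one variable. -/
def IsPolynomialLimit (f : 𝕜 → 𝕜) : Prop :=
  ∀ δ : ℝ, 0 < δ → ∃ P : 𝕜[X], ∀ x, ‖x‖ ≤ 1 → ‖f x - P.eval x‖ ≤ δ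

namespace IsPolynomialLimit

variable {f g : 𝕜 → 𝕜}

theorem of_forall_approx (hf : ∀ δ : ℝ, 0 < δ →
    ∃ g, IsPolynomialLimit g ∧ ∀ x, ‖x‖ ≤ 1 → ‖f x - g x‖ ≤ δ) : IsPolynomialLimit f := by
  intro δ hδ
  obtain ⟨g, hg, hfg⟩ := hf δ hδ
  obtain ⟨P, hP⟩ := hg δ hδ
  refine ⟨P, fun x hx => ?_⟩
  rw [← sub_add_sub_cancel _ (g x)]
  exact (IsUltrametricDist.norm_add_le_max _ _).trans (max_le (hfg x hx) (hP x hx))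

theorem div_X_sub_C (hf : IsPolynomialLimit f) {α : 𝕜} (hα : 1 < ‖α‖) :
    IsPolynomialLimit fun x => f x / (x - α) := by
  intro δ hδ
  obtain ⟨P, hP⟩ := hf δ hδ
  obtain ⟨n, hn⟩ : ∃ n : ℕ, ‖P.eval α / α ^ n‖ ≤ δ := by
    have h := (tendsto_pow_atTop_nhds_zero_of_lt_one (by positivity)
      (inv_lt_one_of_one_lt₀ hα)).const_mul ‖P.eval α‖
    obtain ⟨n, hn⟩ := (h.eventually_le_const (by simpa using hδ)).exists
    exact ⟨n, by simpa [div_eq_mul_inv] using hn⟩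
  have hα0 : α ≠ 0 := norm_pos_iff.1 (one_pos.trans hα)
  obtain ⟨R, hR⟩ : X - C α ∣ P - C (P.eval α / α ^ n) * X ^ n := by
    rw [dvd_iff_isRoot]
    simp [hα0]
  refine ⟨R, fun x hx => ?_⟩
  have hxα : ‖x - α‖ = ‖α‖ := by
    have hne : ‖x‖ ≠ ‖-α‖ := norm_neg α ▸ (hx.trans_lt hα).ne
    rw [sub_eq_add_neg, IsUltrametricDist.norm_add_eq_max_of_norm_ne_norm hne, norm_neg,
      max_eq_right (hx.trans hα.le)]
  have hxα0 : x - α ≠ 0 := norm_pos_iff.1 (hxα ▸ one_pos.trans hα)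
  have hRx := congrArg (eval x) hR
  simp only [eval_sub, eval_mul, eval_C, eval_pow, eval_X] at hRx
  have herr : f x / (x - α) - R.eval x =
      (f x - P.eval x + P.eval α / α ^ n * x ^ n) / (x - α) := by
    rw [eq_div_iff hxα0, sub_mul, div_mul_cancel₀ _ hxα0]
    linear_combination hRx
  rw [herr, norm_div, hxα]
  refine div_le_of_le_mul₀ (by positivity) hδ.le ?_
  refine (IsUltrametricDist.norm_add_le_max _ _).trans (max_le ((hP x hx).trans ?_) ?_)
  · exact le_mul_of_one_le_right hδ.le hα.le
  · rw [norm_mul, norm_pow]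
    exact mul_le_mul hn ((pow_le_one₀ (norm_nonneg _) hx).trans hα.le) (by positivity) hδ.le

theorem of_eval_div_eval [IsAlgClosed 𝕜] (P : 𝕜[X]) {Q : 𝕜[X]}
    (hQ : ∀ x, ‖x‖ ≤ 1 → Q.eval x ≠ 0) :
    IsPolynomialLimit fun x => P.eval x / Q.eval x := by
  have hroots (s : Multiset 𝕜) (hs : ∀ α ∈ s, 1 < ‖α‖) :
      IsPolynomialLimit fun x => (C Q.leadingCoeff⁻¹ * P).eval x / (s.map (x - ·)).prod := by
    induction s using Multiset.induction_on with
    | empty => exact fun δ hδ => ⟨C Q.leadingCoeff⁻¹ * P, fun x _ => by simpa using hδ.le⟩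
    | cons α s ih =>
      have h := (ih fun β hβ => hs β (Multiset.mem_cons_of_mem hβ)).div_X_sub_C
        (hs α (Multiset.mem_cons_self α s))
      simpa only [Multiset.map_cons, Multiset.prod_cons, div_div, mul_comm] using h
  convert hroots Q.roots fun α hα => lt_of_not_ge fun h => hQ α h (isRoot_of_mem_roots hα) using 2
    with x
  rw [(IsAlgClosed.splits Q).eval_eq_prod_roots, eval_mul, eval_C]
  ring

theorem exists_norm_sub_coeff_le [IsAlgClosed 𝕜] [CompleteSpace 𝕜] (hf : IsPolynomialLimit f) :
    ∃ a : ℕ → 𝕜, ∀ δ : ℝ, 0 < δ → ∃ P : 𝕜[X],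
      (∀ x, ‖x‖ ≤ 1 → ‖f x - P.eval x‖ ≤ δ) ∧ ∀ n, ‖a n - P.coeff n‖ ≤ δ := by
  choose! P hP using hf
  have hPP {δ δ' : ℝ} (hδ : 0 < δ) (h : δ' ≤ δ) (hδ' : 0 < δ') (n : ℕ) :
      ‖(P δ').coeff n - (P δ).coeff n‖ ≤ δ := by
    rw [← coeff_sub]
    refine norm_coeff_le (fun x hx => ?_) n
    rw [eval_sub, ← sub_sub_sub_cancel_left _ _ (f x)]
    exact (norm_sub_le_max _ _).trans (max_le (hP δ hδ x hx) ((hP δ' hδ' x hx).trans h))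
  obtain ⟨u, hu, hupos, hulim⟩ := exists_seq_strictAnti_tendsto (0 : ℝ)
  have hlim (n : ℕ) : ∃ a, Tendsto (fun i => (P (u i)).coeff n) atTop (𝓝 a) := by
    refine cauchySeq_tendsto_of_complete (cauchySeq_of_le_tendsto_0' u (fun i j hij => ?_) hulim)
    rw [dist_comm, dist_eq_norm]
    exact hPP (hupos i) (hu.antitone hij) (hupos j) n
  choose a ha using hlim
  refine ⟨a, fun δ hδ => ⟨P δ, hP δ hδ, fun n => ?_⟩⟩
  refine le_of_tendsto ((ha n).sub_const _).norm ?_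
  filter_upwards [hulim.eventually_le_const hδ] with i hi
  exact hPP hδ hi (hupos i) n

theorem exists_hasSum [IsAlgClosed 𝕜] [CompleteSpace 𝕜] (hf : IsPolynomialLimit f) :
    ∃ a : ℕ → 𝕜, ∀ x, ‖x‖ ≤ 1 → HasSum (fun n => a n * x ^ n) (f x) := by
  obtain ⟨a, ha⟩ := hf.exists_norm_sub_coeff_le
  refine ⟨a, fun x hx => ?_⟩
  have hnorm (b : 𝕜) (n : ℕ) : ‖b * x ^ n‖ ≤ ‖b‖ := by
    rw [norm_mul, norm_pow]
    exact mul_le_of_le_one_right (norm_nonneg _) (pow_le_one₀ (norm_nonneg _) hx)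
  have ha0 : Tendsto a atTop (𝓝 0) := by
    refine Metric.nhds_basis_closedBall.tendsto_right_iff.2 fun δ hδ => ?_
    obtain ⟨P, -, haP⟩ := ha δ hδ
    filter_upwards [eventually_gt_atTop P.natDegree] with n hn
    simpa [coeff_eq_zero_of_natDegree_lt hn] using haP n
  have hsum : Summable fun n => a n * x ^ n := by
    refine NonarchimedeanAddGroup.summable_of_tendsto_cofinite_zero ?_
    rw [Nat.cofinite_eq_atTop]
    exact squeeze_zero_norm (fun n => hnorm (a n) n) (by simpa using ha0.norm)
  convert hsum.hasSum
  refine eq_of_forall_dist_le fun δ hδ => ?_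
  obtain ⟨P, hfP, haP⟩ := ha δ hδ
  have hPx : HasSum (fun n => P.coeff n * x ^ n) (P.eval x) := by
    rw [eval_eq_sum_range]
    refine hasSum_sum_of_ne_finset_zero fun n hn => ?_
    rw [coeff_eq_zero_of_natDegree_lt (by simpa using hn), zero_mul]
  have haPx : ‖∑' n, a n * x ^ n - P.eval x‖ ≤ δ := by
    rw [← hPx.tsum_eq, ← hsum.tsum_sub hPx.summable]
    refine IsUltrametricDist.norm_tsum_le_of_forall_le_of_nonneg hδ.le fun n => ?_
    rw [← sub_mul]
    exact (hnorm _ n).trans (haP n)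
  rw [dist_eq_norm, ← sub_sub_sub_cancel_right _ _ (P.eval x)]
  exact (norm_sub_le_max _ _).trans (max_le (hfP x hx) haPx)

end IsPolynomialLimit

end PolynomialLimit

section CInfField

variable (F : Type*) [Field F] [Finite F]

instance isUltrametricDist_CInf : IsUltrametricDist (CInf F) :=
  IsUltrametricDist.of_normedAlgebra (KInf F)

instance isAlgClosed_CInf : IsAlgClosed (CInf F) :=
  isAlgClosed_of_denseRange (K := KInfAlg F) UniformSpace.Completion.denseRange_coe

theorem isClosed_range_KInf : IsClosed (Set.range (algebraMap (KInf F) (CInf F))) :=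
  (algebraMap_isometry (KInf F) (CInf F)).isClosedEmbedding.isClosed_range

variable {F}

theorem norm_ofK (x : K F) (hx : x ≠ 0) : ‖ofK x‖ = (Nat.card F : ℝ) ^ x.intDegree := by
  classical
  have h : Valued.v (algebraMap (RatFunc F) (KInf F) x) = WithZero.exp x.intDegree := by
    let _ := RatFunc.inftyValued F
    exact (RatFunc.valuedCompletionAtInfty.def F).trans
      ((Valued.extensionValuation_apply_coe (K := RatFunc F) x).trans
        (RatFunc.inftyValuation_of_nonzero F hx))
  rw [ofK, RingHom.comp_apply, norm_algebraMap']
  change ((WithZeroMulInt.toNNReal (one_lt_card F).ne_zero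
    (MonoidWithZeroHom.ValueGroup₀.embedding ((Valued.v : Valuation (KInf F) _).restrict _)) :
      ℝ≥0) : ℝ) = _
  rw [Valuation.embedding_restrict, h]
  rw [WithZeroMulInt.toNNReal_neg_apply _ WithZero.exp_ne_zero]
  simp [WithZero.exp]

theorem norm_ofA {a : A F} (ha : a ≠ 0) : ‖ofA a‖ = (Nat.card F : ℝ) ^ a.natDegree := by
  have h := norm_ofK (algebraMap (A F) (K F) a) (by simpa using ha)
  rw [RatFunc.intDegree_polynomial] at h
  exact_mod_cast h

theorem card_eq_zero : (Nat.card F : CInf F) = 0 := by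
  have : Fintype F := Fintype.ofFinite F
  rw [Nat.card_eq_fintype_card, ← map_natCast ((ofA (F := F)).comp C)]
  simp

end CInfField

section Substitution

theorem hasSum_sum_range_of_hasSum_prod {M : Type*} [AddCommMonoid M] [TopologicalSpace M]
    [ContinuousAdd M] [RegularSpace M] {T : ℕ × ℕ → M} {S : M} (h : HasSum T S) :
    HasSum (fun n => ∑ j ∈ Finset.range (n + 1), T (n - j, j)) S := by
  have hsigma := (Finset.HasAntidiagonal.sigmaAntidiagonalEquivProd.hasSum_iff.2 h).sigma
    (g := fun n => ∑ p ∈ Finset.HasAntidiagonal.antidiagonal n, T p)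
    fun n => (Finset.HasAntidiagonal.antidiagonal n).hasSum T
  refine hsigma.congr_fun fun n => ?_
  rw [← Finset.Nat.sum_antidiagonal_swap, Finset.Nat.sum_antidiagonal_eq_sum_range_succ_mk]
  rfl

variable {𝕜 : Type*} [NontriviallyNormedField 𝕜] [IsUltrametricDist 𝕜]

theorem norm_one_sub_eq_one {u : 𝕜} (hu : ‖u‖ < 1) : ‖1 - u‖ = 1 := by
  have hne : ‖(1 : 𝕜)‖ ≠ ‖-u‖ := by simpa using hu.ne'
  rw [sub_eq_add_neg, IsUltrametricDist.norm_add_eq_max_of_norm_ne_norm hne]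
  simpa using hu.le

variable [CompleteSpace 𝕜] {a : ℕ → 𝕜} {x S : 𝕜}

theorem summable_choose_mul_comp_div_one_sub {u : 𝕜} (hu : ‖u‖ < 1)
    (hS : Summable fun i => a i * (x / (1 - u)) ^ i) (M : ℕ) :
    Summable fun p : ℕ × ℕ => a p.1 * x ^ p.1 * ((M + p.1 + p.2).choose p.2 * u ^ p.2) := by
  have : NonarchimedeanRing 𝕜 := ⟨NonarchimedeanAddGroup.is_nonarchimedean⟩
  have hnorm (i : ℕ) : ‖a i * (x / (1 - u)) ^ i‖ = ‖a i * x ^ i‖ := by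
    rw [norm_mul, norm_mul, norm_pow, norm_div, norm_one_sub_eq_one hu, div_one, norm_pow]
  have hax : Summable fun i => a i * x ^ i := by
    refine NonarchimedeanAddGroup.summable_of_tendsto_cofinite_zero ?_
    refine tendsto_zero_iff_norm_tendsto_zero.2 ?_
    exact (tendsto_zero_iff_norm_tendsto_zero.1 hS.tendsto_cofinite_zero).congr hnorm
  have hprod := hax.mul_of_nonarchimedean (summable_geometric_of_norm_lt_one hu)
  refine NonarchimedeanAddGroup.summable_of_tendsto_cofinite_zero
    (squeeze_zero_norm (fun p => ?_) (tendsto_zero_iff_norm_tendsto_zero.1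
      hprod.tendsto_cofinite_zero))
  rw [norm_mul, norm_mul (Nat.cast _), norm_mul (a p.1 * _)]
  gcongr
  exact mul_le_of_le_one_left (norm_nonneg _) (IsUltrametricDist.norm_natCast_le_one 𝕜 _)

theorem hasSum_choose_mul_comp_div_one_sub {u : 𝕜} (hu : ‖u‖ < 1)
    (hS : HasSum (fun i => a i * (x / (1 - u)) ^ i) S) (M : ℕ) :
    HasSum (fun p : ℕ × ℕ => a p.1 * x ^ p.1 * ((M + p.1 + p.2).choose p.2 * u ^ p.2))
      (S / (1 - u) ^ (M + 1)) := by
  have hu0 : 1 - u ≠ 0 := norm_pos_iff.1 (norm_one_sub_eq_one hu ▸ one_pos)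
  have hsum := (summable_choose_mul_comp_div_one_sub hu hS.summable M).hasSum
  have hfiber (i : ℕ) : HasSum
      (fun s => a i * x ^ i * (((M + i + s).choose s : 𝕜) * u ^ s))
      (a i * (x / (1 - u)) ^ i / (1 - u) ^ (M + 1)) := by
    have hval : a i * (x / (1 - u)) ^ i / (1 - u) ^ (M + 1) =
        a i * x ^ i * (1 / (1 - u) ^ (M + i + 1)) := by
      rw [div_pow, add_right_comm, pow_add (1 - u)]
      field_simp
      ring
    rw [hval]
    refine ((hasSum_choose_mul_geometric_of_norm_lt_one (M + i) hu).mul_left _).congr_fun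
      fun s => ?_
    rw [add_comm s, Nat.choose_symm_add]
  exact (hsum.prod_fiberwise hfiber).unique (hS.div_const _) ▸ hsum

theorem hasSum_comp_div_one_sub_mul {t : 𝕜} (hx : ‖t * x‖ < 1)
    (hS : HasSum (fun i => a i * (x / (1 - t * x)) ^ i) S) (M : ℕ) :
    HasSum (fun n => (∑ j ∈ Finset.range (n + 1), (M + n).choose j * t ^ j * a (n - j)) * x ^ n)
      (S / (1 - t * x) ^ (M + 1)) := by
  refine (hasSum_sum_range_of_hasSum_prod
    (hasSum_choose_mul_comp_div_one_sub hx hS M)).congr_fun fun n => ?_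
  rw [Finset.sum_mul]
  refine Finset.sum_congr rfl fun j hj => ?_
  have hjn : n - j + j = n := Nat.sub_add_cancel (Finset.mem_range_succ_iff.1 hj)
  have hpow : x ^ n = x ^ (n - j) * x ^ j := by rw [← pow_add, hjn]
  rw [add_assoc, hjn, hpow, mul_pow]
  ring

end Substitution

section Affinoid

variable {F : Type*} [Field F] [Finite F]

theorem exists_mem_affinoid (z : Omega F) : ∃ n, z ∈ affinoid F n := by
  have hpos := ((isClosed_range_KInf F).notMem_iff_infDist_pos ⟨_, 0, rfl⟩).1 z.2
  have hq : (1 : ℝ) < Nat.card F := one_lt_card F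
  set d := Metric.infDist (z : CInf F) (Set.range (algebraMap (KInf F) (CInf F)))
  obtain ⟨n, hn⟩ :=
    ((tendsto_pow_atTop_atTop_of_one_lt hq).eventually_ge_atTop (max ‖(z : CInf F)‖ d⁻¹)).exists
  refine ⟨n, (le_max_left _ _).trans hn, fun x => ?_⟩
  rw [← dist_eq_norm_sub]
  exact (inv_le_of_inv_le₀ hpos ((le_max_right _ _).trans hn)).trans
    (Metric.infDist_le_dist_of_mem ⟨x, rfl⟩)

variable {n : ℕ} {z : Omega F}

theorem add_mem_affinoid (hz : z ∈ affinoid F n) {ε : CInf F}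
    (hε : ‖ε‖ < ((Nat.card F : ℝ) ^ n)⁻¹) :
    ∃ h : (z : CInf F) + ε ∉ Set.range (algebraMap (KInf F) (CInf F)),
      (⟨z + ε, h⟩ : Omega F) ∈ affinoid F n := by
  have hq : (1 : ℝ) ≤ (Nat.card F : ℝ) ^ n := one_le_pow₀ (one_lt_card F).le
  have hdist (x : KInf F) : ((Nat.card F : ℝ) ^ n)⁻¹ ≤
      ‖(z : CInf F) + ε - algebraMap (KInf F) (CInf F) x‖ := by
    have hlt := hε.trans_le (hz.2 x)
    rw [add_sub_right_comm, IsUltrametricDist.norm_add_eq_max_of_norm_ne_norm hlt.ne']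
    exact (hz.2 x).trans (le_max_left _ _)
  refine ⟨?_, ?_, hdist⟩
  · rintro ⟨x, hx⟩
    have := hdist x
    rw [hx, sub_self, norm_zero] at this
    exact absurd this (not_le.2 (inv_pos.2 (one_pos.trans_le hq)))
  · exact (IsUltrametricDist.norm_add_le_max _ _).trans
      (max_le hz.1 (hε.le.trans ((inv_le_one_of_one_le₀ hq).trans hq)))

theorem norm_left_le_of_mem_affinoid (hz : z ∈ affinoid F n) (a b : KInf F) :
    ‖a‖ ≤ (Nat.card F : ℝ) ^ n *
      ‖algebraMap (KInf F) (CInf F) a * z + algebraMap (KInf F) (CInf F) b‖ := by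
  have hq : (0 : ℝ) < (Nat.card F : ℝ) ^ n := pow_pos (one_pos.trans (one_lt_card F)) n
  rcases eq_or_ne a 0 with rfl | ha
  · rw [norm_zero]
    positivity
  · have ha' : algebraMap (KInf F) (CInf F) a ≠ 0 := by simpa using ha
    have hfactor : algebraMap (KInf F) (CInf F) a * z + algebraMap (KInf F) (CInf F) b =
        algebraMap (KInf F) (CInf F) a * (z - algebraMap (KInf F) (CInf F) (-b / a)) := by
      rw [map_div₀, map_neg]
      field_simp
      ring
    rw [hfactor, norm_mul, norm_algebraMap', mul_left_comm]
    refine le_mul_of_one_le_right (norm_nonneg a) ?_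
    rw [← inv_le_iff_one_le_mul₀' hq]
    exact hz.2 _

theorem max_norm_le_of_mem_affinoid (hz : z ∈ affinoid F n) (a b : KInf F) :
    max ‖a‖ ‖b‖ ≤ (Nat.card F : ℝ) ^ (2 * n) *
      ‖algebraMap (KInf F) (CInf F) a * z + algebraMap (KInf F) (CInf F) b‖ := by
  have hq : (1 : ℝ) ≤ (Nat.card F : ℝ) ^ n := one_le_pow₀ (one_lt_card F).le
  set y := algebraMap (KInf F) (CInf F) a * z + algebraMap (KInf F) (CInf F) b with hy
  have ha : ‖a‖ ≤ (Nat.card F : ℝ) ^ n * ‖y‖ := norm_left_le_of_mem_affinoid hz a b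
  have hb : ‖b‖ ≤ max ‖y‖ (‖a‖ * (Nat.card F : ℝ) ^ n) := by
    calc ‖b‖ = ‖y - algebraMap (KInf F) (CInf F) a * z‖ := by
          rw [hy, add_sub_cancel_left, norm_algebraMap']
      _ ≤ max ‖y‖ ‖algebraMap (KInf F) (CInf F) a * z‖ := norm_sub_le_max _ _
      _ ≤ _ := by
        rw [norm_mul, norm_algebraMap']
        gcongr
        exact hz.1
  have hy1 : ‖y‖ ≤ (Nat.card F : ℝ) ^ (2 * n) * ‖y‖ :=
    le_mul_of_one_le_left (norm_nonneg y) (one_le_pow₀ (one_lt_card F).le)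
  have hy2 : ‖a‖ * (Nat.card F : ℝ) ^ n ≤ (Nat.card F : ℝ) ^ (2 * n) * ‖y‖ := by
    rw [two_mul, pow_add, mul_right_comm]
    gcongr
  exact max_le ((le_mul_of_one_le_right (norm_nonneg a) hq).trans hy2) (hb.trans (max_le hy1 hy2))

end Affinoid

section Expansion

variable {F : Type*} [Field F] [Finite F]

/-- The power series `∑ a_n ε^n` represents `ε ↦ f(z + ε)` near `0`; its coefficients are then the
hyperderivatives of `f` at `z`. -/
def HasExpansion (f : Omega F → CInf F) (z : Omega F) (a : ℕ → CInf F) : Prop :=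
  ∀ᶠ ε in 𝓝 (0 : CInf F),
    ∃ hε : (z : CInf F) + ε ∉ Set.range (algebraMap (KInf F) (CInf F)),
      HasSum (fun i => a i * ε ^ i) (f ⟨z + ε, hε⟩)

variable {f g : Omega F → CInf F} {z : Omega F} {a b : ℕ → CInf F}

theorem HasExpansion.hasFPowerSeriesAt (h : HasExpansion f z a) :
    HasFPowerSeriesAt (Function.extend Subtype.val f 0)
      (FormalMultilinearSeries.ofScalars (CInf F) a) (z : CInf F) := by
  rw [hasFPowerSeriesAt_iff]
  filter_upwards [h] with ε hε
  obtain ⟨hmem, hsum⟩ := hε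
  rw [← Subtype.val_injective.extend_apply f 0] at hsum
  refine hsum.congr_fun fun n => ?_
  rw [FormalMultilinearSeries.coeff_ofScalars, smul_eq_mul, mul_comm]

theorem HasExpansion.unique (ha : HasExpansion f z a) (hb : HasExpansion f z b) : a = b := by
  have h := ha.hasFPowerSeriesAt.eq_formalMultilinearSeries hb.hasFPowerSeriesAt
  funext n
  simpa only [FormalMultilinearSeries.coeff_ofScalars] using congrArg (·.coeff n) h

theorem HasExpansion.hyperDeriv_eq (ha : HasExpansion f z a) (n : ℕ) :
    hyperDeriv n f z = a n := by
  have h : ∃ a, HasExpansion f z a := ⟨a, ha⟩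
  calc hyperDeriv n f z = h.choose n := dif_pos h
    _ = a n := by rw [h.choose_spec.unique ha]

theorem HasExpansion.add (hf : HasExpansion f z a) (hg : HasExpansion g z b) :
    HasExpansion (f + g) z (a + b) := by
  filter_upwards [hf, hg] with ε ⟨hε, hfε⟩ ⟨_, hgε⟩
  exact ⟨hε, (hfε.add hgε).congr_fun fun n => add_mul _ _ _⟩

theorem HasExpansion.const_smul (hf : HasExpansion f z a) (c : CInf F) :
    HasExpansion (c • f) z (c • a) := by
  filter_upwards [hf] with ε ⟨hε, hfε⟩
  exact ⟨hε, (hfε.mul_left c).congr_fun fun n => mul_assoc _ _ _⟩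

theorem IsRigidAnalytic.isPolynomialLimit (hf : IsRigidAnalytic f) {n : ℕ}
    (hz : z ∈ affinoid F n) {ρ : CInf F} (hρ : ‖ρ‖ < ((Nat.card F : ℝ) ^ n)⁻¹) :
    IsPolynomialLimit fun x => Function.extend Subtype.val f 0 (z + ρ * x) := by
  refine IsPolynomialLimit.of_forall_approx fun δ hδ => ?_
  obtain ⟨P, Q, hPQ⟩ := hf n δ hδ
  have hx (x : CInf F) (hx : ‖x‖ ≤ 1) : Q.eval (z + ρ * x) ≠ 0 ∧
      ‖Function.extend Subtype.val f 0 (z + ρ * x) -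
        P.eval (z + ρ * x) / Q.eval (z + ρ * x)‖ ≤ δ := by
    obtain ⟨hΩ, haff⟩ := add_mem_affinoid hz (ε := ρ * x) <|
      (norm_mul ρ x).trans_lt ((mul_le_of_le_one_right (norm_nonneg ρ) hx).trans_lt hρ)
    rw [Subtype.val_injective.extend_apply f 0 ⟨_, hΩ⟩]
    exact hPQ _ haff
  have heval (R : (CInf F)[X]) (x : CInf F) :
      (R.comp (C (z : CInf F) + C ρ * X)).eval x = R.eval (z + ρ * x) := by simp
  refine ⟨_, .of_eval_div_eval (P.comp (C (z : CInf F) + C ρ * X)) (Q := Q.comp _)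
    fun x h => heval Q x ▸ (hx x h).1, fun x h => ?_⟩
  rw [heval, heval]
  exact (hx x h).2

theorem IsRigidAnalytic.hasExpansion (hf : IsRigidAnalytic f) (z : Omega F) :
    HasExpansion f z (fun n => hyperDeriv n f z) := by
  suffices ∃ a, HasExpansion f z a by
    obtain ⟨a, ha⟩ := this
    simpa only [ha.hyperDeriv_eq] using ha
  obtain ⟨n, hz⟩ := exists_mem_affinoid z
  have hq : (0 : ℝ) < Nat.card F := one_pos.trans (one_lt_card F)
  obtain ⟨ρ, hρ0, hρ⟩ := NormedField.exists_norm_lt (CInf F) (inv_pos.2 (pow_pos hq n))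
  obtain ⟨a, ha⟩ := (hf.isPolynomialLimit hz hρ).exists_hasSum
  refine ⟨fun n => a n / ρ ^ n, ?_⟩
  filter_upwards [Metric.ball_mem_nhds (0 : CInf F) hρ0] with ε hε
  rw [mem_ball_zero_iff] at hε
  obtain ⟨hΩ, -⟩ := add_mem_affinoid hz (hε.trans hρ)
  have hsum := ha (ε / ρ) (by rw [norm_div]; exact div_le_one_of_le₀ hε.le hρ0.le)
  rw [mul_div_cancel₀ _ (norm_pos_iff.1 hρ0),
    Subtype.val_injective.extend_apply f 0 ⟨_, hΩ⟩] at hsum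
  exact ⟨hΩ, hsum.congr_fun fun n => by rw [div_pow]; ring⟩

end Expansion

section Slash

variable {F : Type*} [Field F] [Finite F]
variable {γ : GL (Fin 2) (K F)} {z w : Omega F} {x : CInf F}

theorem ofK_det (γ : GL (Fin 2) (K F)) :
    ofK (γ.det : K F) = ofK (γ 0 0) * ofK (γ 1 1) - ofK (γ 0 1) * ofK (γ 1 0) := by
  rw [Matrix.GeneralLinearGroup.val_det_apply, Matrix.det_fin_two, map_sub, map_mul, map_mul]

theorem ofK_det_ne_zero (γ : GL (Fin 2) (K F)) : ofK (γ.det : K F) ≠ 0 :=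
  (_root_.map_ne_zero _).2 γ.det.ne_zero

theorem den_mul_one_sub (hw : ((w : CInf F) - z) * (1 - ofK (γ 1 0) / den γ z * x) = x) :
    den γ w * (1 - ofK (γ 1 0) / den γ z * x) = den γ z := by
  have hJ : ofK (γ 1 0) / den γ z * den γ z = ofK (γ 1 0) := div_mul_cancel₀ _ (den_ne_zero γ z)
  have hden : den γ w = den γ z + ofK (γ 1 0) * (w - z) := by
    rw [den, den]
    ring
  rw [hden]
  linear_combination ofK (γ 1 0) * hw - x * hJ

theorem moebius_eq_add (hw : ((w : CInf F) - z) * (1 - ofK (γ 1 0) / den γ z * x) = x) :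
    (moebius γ w : CInf F) = moebius γ z + ofK (γ.det : K F) * x / den γ z ^ 2 := by
  have hJ := den_ne_zero γ z
  have hJx := den_mul_one_sub hw
  have hx := right_ne_zero_of_mul (hJx ▸ hJ)
  have hnum : num γ w * (1 - ofK (γ 1 0) / den γ z * x) =
      num γ z + ofK (γ.det : K F) * x / den γ z := by
    have hsub : num γ w = num γ z + ofK (γ 0 0) * (w - z) := by
      rw [num, num]
      ring
    rw [hsub, add_mul, mul_assoc, hw, ofK_det, num]
    field_simp
    rw [den]
    ring
  calc (moebius γ w : CInf F) = num γ w / den γ w := rfl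
    _ = (num γ z + ofK (γ.det : K F) * x / den γ z) / den γ z := by
      rw [← hnum, ← mul_div_mul_right (num γ w) _ hx, hJx]
    _ = num γ z / den γ z + ofK (γ.det : K F) * x / den γ z ^ 2 := by
      rw [add_div, div_div, sq]

theorem apply_moebius (k m : ℤ) (f : Omega F → CInf F) (γ : GL (Fin 2) (K F)) (z : Omega F) :
    f (moebius γ z) = ofK (γ.det : K F) ^ (-m) * den γ z ^ k * slash k m f γ z := by
  have hJ := den_ne_zero γ z
  have hδ := ofK_det_ne_zero γ
  rw [slash, zpow_neg, zpow_neg]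
  field_simp

theorem apply_moebius_eq_mul_slash_div (M : ℕ) (m : ℤ) (f : Omega F → CInf F)
    (hw : ((w : CInf F) - z) * (1 - ofK (γ 1 0) / den γ z * x) = x) :
    f (moebius γ w) = ofK (γ.det : K F) ^ (-m) * den γ z ^ (M + 1) *
      (slash (M + 1) m f γ w / (1 - ofK (γ 1 0) / den γ z * x) ^ (M + 1)) := by
  have hden := den_mul_one_sub hw
  have hx := right_ne_zero_of_mul (hden ▸ den_ne_zero γ z)
  have hpow : den γ z ^ (M + 1) =
      den γ w ^ (M + 1) * (1 - ofK (γ 1 0) / den γ z * x) ^ (M + 1) := by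
    rw [← mul_pow, hden]
  rw [apply_moebius (M + 1) m f, hpow, mul_assoc, mul_assoc, mul_assoc,
    mul_div_cancel₀ _ (pow_ne_zero _ hx)]
  norm_cast

theorem HasExpansion.of_slash {M : ℕ} {m : ℤ} {h : Omega F → CInf F} {a : ℕ → CInf F}
    (ha : HasExpansion (slash (M + 1) m h γ) z a) :
    HasExpansion h (moebius γ z) fun n =>
      ofK (γ.det : K F) ^ (-(m + n)) * den γ z ^ (M + 1 + 2 * n : ℤ) *
        ∑ j ∈ Finset.range (n + 1), (M + n).choose j * (ofK (γ 1 0) / den γ z) ^ j * a (n - j) := by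
  have hJ := den_ne_zero γ z
  have hδ := ofK_det_ne_zero γ
  set J := den γ z with hJdef
  set δ := ofK (γ.det : K F) with hδdef
  set t := ofK (γ 1 0) / J with ht
  have hx0 : Tendsto (fun η : CInf F => J ^ 2 / δ * η) (𝓝 0) (𝓝 0) :=
    (continuous_const_mul _).tendsto' 0 0 (mul_zero _)
  have hε0 : Tendsto (fun x : CInf F => x / (1 - t * x)) (𝓝 0) (𝓝 0) := by
    have h : ContinuousAt (fun x : CInf F => x / (1 - t * x)) 0 := by fun_prop (disch := simp)
    simpa [ContinuousAt] using h
  have hlt : ∀ᶠ x : CInf F in 𝓝 0, ‖t * x‖ < 1 :=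
    ((continuous_const_mul t).norm.tendsto' 0 0 (by simp)).eventually_lt_const one_pos
  filter_upwards [hx0.eventually ((hε0.eventually ha).and hlt)] with η ⟨⟨hw, hsum⟩, hη⟩
  have hu : 1 - t * (J ^ 2 / δ * η) ≠ 0 := norm_pos_iff.1 (norm_one_sub_eq_one hη ▸ one_pos)
  have hη' : δ * (J ^ 2 / δ * η) / J ^ 2 = η := by field_simp
  set x := J ^ 2 / δ * η with hx
  set w : Omega F := ⟨z + x / (1 - t * x), hw⟩ with hwdef
  have hwx : ((w : CInf F) - z) * (1 - t * x) = x := by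
    rw [hwdef, add_sub_cancel_left, div_mul_cancel₀ _ hu]
  have hmoebius : (moebius γ w : CInf F) = moebius γ z + η := by rw [moebius_eq_add hwx, hη']
  refine ⟨hmoebius ▸ (moebius γ w).2, ?_⟩
  simp only [← hmoebius]
  rw [apply_moebius_eq_mul_slash_div M m h hwx, ← hδdef, ← hJdef, ← ht]
  refine ((hasSum_comp_div_one_sub_mul hη hsum M).mul_left _).congr_fun fun n => ?_
  have hJn : J ^ (M + 1 + 2 * n : ℤ) = J ^ (M + 1) * (J ^ 2) ^ n := by
    rw [← pow_mul, ← pow_add]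
    norm_cast
  rw [hJn, hx, mul_pow, div_pow, neg_add, zpow_add₀ hδ, zpow_neg δ n, zpow_natCast]
  field_simp

theorem slash_hyperDeriv {M : ℕ} {m : ℤ} {h : Omega F → CInf F} {a : ℕ → CInf F}
    (ha : HasExpansion (slash (M + 1) m h γ) z a) (n : ℕ) :
    slash (M + 1 + 2 * n) (m + n) (hyperDeriv n h) γ z =
      ∑ j ∈ Finset.range (n + 1), (M + n).choose j * (ofK (γ 1 0) / den γ z) ^ j * a (n - j) := by
  have hJ := den_ne_zero γ z
  have hδ := ofK_det_ne_zero γ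
  rw [slash, ha.of_slash.hyperDeriv_eq, zpow_neg, zpow_neg]
  field_simp

theorem slash_normDeriv (π : CInf F) {M : ℕ} {m : ℤ} {h : Omega F → CInf F} {a : ℕ → CInf F}
    (ha : HasExpansion (slash (M + 1) m h γ) z a) (n : ℕ) :
    slash (M + 1 + 2 * n) (m + n) (normDeriv π n h) γ z =
      ∑ j ∈ Finset.range (n + 1), ((-π) ^ j)⁻¹ * (M + n).choose j *
        (((-π) ^ (n - j))⁻¹ * a (n - j)) * (ofK (γ 1 0) / den γ z) ^ j := by
  have hsmul : slash (M + 1 + 2 * n) (m + n) (normDeriv π n h) γ z =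
      ((-π) ^ n)⁻¹ * slash (M + 1 + 2 * n) (m + n) (hyperDeriv n h) γ z := by
    simp only [slash, normDeriv, Pi.smul_apply, smul_eq_mul]
    ring
  rw [hsmul, slash_hyperDeriv ha, Finset.mul_sum]
  refine Finset.sum_congr rfl fun j hj => ?_
  rw [← pow_sub_mul_pow (-π) (Finset.mem_range_succ_iff.1 hj), mul_inv]
  ring

theorem slash_normDeriv_of_slash_eq (π : CInf F) {M : ℕ} {m : ℤ} {h : Omega F → CInf F}
    (hh : IsRigidAnalytic h) (hγ : slash (M + 1) m h γ = h) (n : ℕ) (z : Omega F) :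
    slash (M + 1 + 2 * n) (m + n) (normDeriv π n h) γ z =
      ∑ j ∈ Finset.range (n + 1), ((-π) ^ j)⁻¹ * (M + n).choose j *
        normDeriv π (n - j) h z * (ofK (γ 1 0) / den γ z) ^ j :=
  slash_normDeriv π (a := fun i => hyperDeriv i h z) (by rw [hγ]; exact hh.hasExpansion z) n

theorem hasExpansion_div_den (γ : GL (Fin 2) (K F)) (z : Omega F) :
    HasExpansion (fun z => ofK (γ 1 0) / den γ z) z
      fun i => (-1) ^ i * (ofK (γ 1 0) / den γ z) ^ (i + 1) := by
  have hJ := den_ne_zero γ z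
  have hΩ : ∀ᶠ ε : CInf F in 𝓝 0, (z : CInf F) + ε ∈
      (Set.range (algebraMap (KInf F) (CInf F)))ᶜ :=
    ((continuous_const_add (z : CInf F)).tendsto' 0 z (add_zero _)).eventually
      ((isClosed_range_KInf F).isOpen_compl.mem_nhds z.2)
  have hlt : ∀ᶠ ε : CInf F in 𝓝 0, ‖-(ofK (γ 1 0) / den γ z * ε)‖ < 1 :=
    ((continuous_const_mul _).neg.norm.tendsto' 0 0 (by simp)).eventually_lt_const one_pos
  filter_upwards [hΩ, hlt] with ε hε hlt
  refine ⟨hε, ?_⟩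
  have hden : den γ ⟨_, hε⟩ = den γ z * (1 - -(ofK (γ 1 0) / den γ z * ε)) := by
    field_simp
    rw [den, den]
    ring
  rw [hden, ← div_div, div_eq_mul_inv _ (1 - _)]
  exact ((hasSum_geometric_of_norm_lt_one hlt).mul_left _).congr_fun fun i => by ring

theorem sum_range_choose_mul_neg_one_pow (R : Type*) [Ring R] (n : ℕ) :
    ∑ j ∈ Finset.range (n + 1), ((n + 1).choose j : R) * (-1) ^ (n - j) = 1 := by
  have hint : ∑ j ∈ Finset.range (n + 1), ((n + 1).choose j : ℤ) * (-1) ^ (n - j) = 1 := by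
    calc _ = (-1) ^ n * ∑ j ∈ Finset.range (n + 1), (-1) ^ j * ((n + 1).choose j : ℤ) := by
          rw [Finset.mul_sum]
          refine Finset.sum_congr rfl fun j hj => ?_
          rw [← pow_sub_mul_pow (-1 : ℤ) (Finset.mem_range_succ_iff.1 hj), mul_assoc, mul_comm,
            ← mul_assoc ((-1) ^ j), ← mul_pow, neg_one_mul, neg_neg, one_pow, one_mul]
      _ = 1 := by
          rw [Int.alternating_sum_range_choose_eq_choose, Nat.choose_self, ← mul_assoc,
            ← mul_pow]
          simp
  exact_mod_cast congrArg (Int.cast : ℤ → R) hint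

theorem slash_normDeriv_of_slash_eq_sub {π : CInf F} (hπ : π ≠ 0) {h : Omega F → CInf F}
    (hh : IsRigidAnalytic h)
    (hγ : slash 2 1 h γ = h + -π⁻¹ • fun z => ofK (γ 1 0) / den γ z) (n : ℕ) (z : Omega F) :
    slash (2 + 2 * n) (1 + n) (normDeriv π n h) γ z =
      ∑ j ∈ Finset.range (n + 1), ((-π) ^ j)⁻¹ * (n + 1).choose j *
        normDeriv π (n - j) h z * (ofK (γ 1 0) / den γ z) ^ j +
      ((-π) ^ (n + 1))⁻¹ * (ofK (γ 1 0) / den γ z) ^ (n + 1) := by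
  have hexp := (hh.hasExpansion z).add ((hasExpansion_div_den γ z).const_smul (-π⁻¹))
  rw [← hγ] at hexp
  have hslash := slash_normDeriv π (M := 1) (by
    simpa only [Nat.cast_one, one_add_one_eq_two] using hexp) n
  simp only [Nat.cast_one, one_add_one_eq_two, Pi.add_apply, Pi.smul_apply, smul_eq_mul] at hslash
  rw [hslash]
  have hpow {j : ℕ} (hj : j ∈ Finset.range (n + 1)) (y : CInf F) :
      y ^ (n + 1) = y ^ j * y ^ (n - j + 1) := by
    rw [← pow_add]
    have := Finset.mem_range_succ_iff.1 hj
    congr 1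
    lia
  calc _ = ∑ j ∈ Finset.range (n + 1), (((-π) ^ j)⁻¹ * (n + 1).choose j *
          normDeriv π (n - j) h z * (ofK (γ 1 0) / den γ z) ^ j +
        ((-π) ^ (n + 1))⁻¹ * (ofK (γ 1 0) / den γ z) ^ (n + 1) *
          ((n + 1).choose j * (-1) ^ (n - j))) := by
        refine Finset.sum_congr rfl fun j hj => ?_
        rw [hpow hj, hpow hj, pow_succ (-π), add_comm 1 n, normDeriv, Pi.smul_apply, smul_eq_mul]
        field_simp
    _ = _ := by
      rw [Finset.sum_add_distrib, ← Finset.mul_sum, sum_range_choose_mul_neg_one_pow, mul_one]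

end Slash

section RigidAnalytic

variable {F : Type*} [Field F] [Finite F] {f g : Omega F → CInf F}

namespace IsRigidAnalytic

theorem of_eval_div_eval {P Q : (CInf F)[X]} (hQ : ∀ z : Omega F, Q.eval (z : CInf F) ≠ 0) :
    IsRigidAnalytic fun z : Omega F => P.eval (z : CInf F) / Q.eval (z : CInf F) :=
  fun _ ε hε => ⟨P, Q, fun z _ => ⟨hQ z, by simpa using hε.le⟩⟩

theorem zero : IsRigidAnalytic (0 : Omega F → CInf F) :=
  fun _ ε hε => ⟨0, 1, by simp [hε.le]⟩

theorem of_forall_approx (h : ∀ n : ℕ, ∀ ε : ℝ, 0 < ε →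
    ∃ g, IsRigidAnalytic g ∧ ∀ z ∈ affinoid F n, ‖f z - g z‖ ≤ ε) : IsRigidAnalytic f := by
  intro n ε hε
  obtain ⟨g, hg, hfg⟩ := h n ε hε
  obtain ⟨P, Q, hPQ⟩ := hg n ε hε
  refine ⟨P, Q, fun z hz => ⟨(hPQ z hz).1, ?_⟩⟩
  rw [← sub_add_sub_cancel _ (g z)]
  exact (IsUltrametricDist.norm_add_le_max _ _).trans (max_le (hfg z hz) (hPQ z hz).2)

theorem add (hf : IsRigidAnalytic f) (hg : IsRigidAnalytic g) : IsRigidAnalytic (f + g) := by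
  intro n ε hε
  obtain ⟨P₁, Q₁, h₁⟩ := hf n ε hε
  obtain ⟨P₂, Q₂, h₂⟩ := hg n ε hε
  refine ⟨P₁ * Q₂ + Q₁ * P₂, Q₁ * Q₂, fun z hz => ?_⟩
  obtain ⟨hQ₁, hf⟩ := h₁ z hz
  obtain ⟨hQ₂, hg⟩ := h₂ z hz
  rw [eval_mul, eval_add, eval_mul, eval_mul, ← div_add_div _ _ hQ₁ hQ₂, Pi.add_apply,
    add_sub_add_comm]
  exact ⟨mul_ne_zero hQ₁ hQ₂, (IsUltrametricDist.norm_add_le_max _ _).trans (max_le hf hg)⟩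

theorem const_smul (c : CInf F) (hf : IsRigidAnalytic f) : IsRigidAnalytic (c • f) := by
  intro n ε hε
  obtain ⟨P, Q, h⟩ := hf n (ε / (‖c‖ + 1)) (by positivity)
  refine ⟨C c * P, Q, fun z hz => ⟨(h z hz).1, ?_⟩⟩
  rw [eval_mul, eval_C, mul_div_assoc, Pi.smul_apply, smul_eq_mul, ← mul_sub, norm_mul]
  calc _ ≤ (‖c‖ + 1) * (ε / (‖c‖ + 1)) := by
        gcongr
        · exact le_add_of_nonneg_right zero_le_one
        · exact (h z hz).2
    _ = ε := by field_simp

theorem sum {ι : Type*} (s : Finset ι) {f : ι → Omega F → CInf F}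
    (hf : ∀ i ∈ s, IsRigidAnalytic (f i)) : IsRigidAnalytic (∑ i ∈ s, f i) :=
  Finset.sum_induction f IsRigidAnalytic (fun _ _ => add) zero hf

theorem tsum {ι : Type*} {f : ι → Omega F → CInf F} (hf : ∀ i, IsRigidAnalytic (f i))
    {u : ℕ → ι → ℝ} (hu : ∀ n, Tendsto (u n) cofinite (𝓝 0))
    (hfu : ∀ n, ∀ z ∈ affinoid F n, ∀ i, ‖f i z‖ ≤ u n i) :
    IsRigidAnalytic fun z => ∑' i, f i z := by
  refine of_forall_approx fun n ε hε => ?_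
  have hfin := eventually_cofinite.1 ((hu n).eventually_le_const hε)
  refine ⟨∑ i ∈ hfin.toFinset, f i, sum _ fun i _ => hf i, fun z hz => ?_⟩
  have hsum : Summable fun i => f i z :=
    NonarchimedeanAddGroup.summable_of_tendsto_cofinite_zero
      (squeeze_zero_norm (hfu n z hz) (hu n))
  rw [Finset.sum_apply, ← hsum.sum_add_tsum_compl (s := hfin.toFinset), add_sub_cancel_left]
  refine IsUltrametricDist.norm_tsum_le_of_forall_le_of_nonneg hε.le fun i => ?_
  exact (hfu n z hz i).trans (by simpa using i.2)

end IsRigidAnalytic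

end RigidAnalytic

section PolynomialsOverFiniteField

variable {F : Type*} [Field F] [Finite F]

variable (F) in
theorem finite_degreeLT (n : ℕ) : (degreeLT F n : Set (A F)).Finite :=
  have : Finite (degreeLT F n) := Module.finite_of_finite F
  Set.toFinite _

variable (F) in
/-- The polynomials of degree less than `n`, as a finite set. -/
def polysDegreeLT (n : ℕ) : Finset (A F) := (finite_degreeLT F n).toFinset

theorem mem_polysDegreeLT {n : ℕ} {a : A F} : a ∈ polysDegreeLT F n ↔ a.degree < n := by
  simp [polysDegreeLT, mem_degreeLT]

theorem card_polysDegreeLT (n : ℕ) : (polysDegreeLT F n).card = Nat.card F ^ n := by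
  rw [polysDegreeLT, ← Set.ncard_eq_toFinset_card _ (finite_degreeLT F n)]
  exact (Nat.card_congr (degreeLTEquiv F n).toEquiv).trans (by simp [Nat.card_fun])

theorem monotone_polysDegreeLT : Monotone (polysDegreeLT F) := fun _ _ hmn _ ha =>
  mem_polysDegreeLT.2 ((mem_polysDegreeLT.1 ha).trans_le (by exact_mod_cast hmn))

theorem tendsto_polysDegreeLT_prod (d : ℕ) :
    Tendsto (fun n => polysDegreeLT F (n + d) ×ˢ polysDegreeLT F n) atTop atTop := by
  refine tendsto_atTop_finset_of_monotone (fun m n hmn => Finset.product_subset_product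
    (monotone_polysDegreeLT (by lia)) (monotone_polysDegreeLT hmn)) fun p => ?_
  refine ⟨p.1.natDegree + p.2.natDegree + 1, Finset.mem_product.2 ⟨?_, ?_⟩⟩ <;>
  · refine mem_polysDegreeLT.2 (degree_le_natDegree.trans_lt ?_)
    norm_cast
    lia

variable (F) in
/-- A polynomial is determined by its quotient by `X` and its constant term. -/
def divXEquiv : A F ≃ A F × F where
  toFun b := (b.divX, b.coeff 0)
  invFun p := X * p.1 + C p.2
  left_inv b := X_mul_divX_add b
  right_inv p := by
    ext1
    · ext n
      simp [coeff_divX]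
    · simp

theorem sum_polysDegreeLT_succ {F M : Type*} [Field F] [Fintype F] [AddCommMonoid M] (n : ℕ)
    (f : A F → M) :
    ∑ b ∈ polysDegreeLT F (n + 1), f b =
      ∑ b ∈ polysDegreeLT F n, ∑ e : F, f (X * b + C e) := by
  rw [← Finset.sum_product']
  refine Finset.sum_equiv (divXEquiv F) (fun b => ?_) fun b _ => ?_
  · simp only [Finset.mem_product, Finset.mem_univ, and_true, mem_polysDegreeLT,
      degree_lt_iff_coeff_zero, divXEquiv, Equiv.coe_fn_mk, coeff_divX]
    exact ⟨fun h i hi => h _ (by lia), fun h i hi => by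
      obtain ⟨j, rfl⟩ := Nat.exists_eq_add_of_lt (Nat.lt_of_lt_of_le n.succ_pos hi)
      simpa using h j (by lia)⟩
  · exact congrArg f (X_mul_divX_add b).symm

theorem hasSum_monic_prod_units {F M : Type*} [Field F] [AddCommMonoid M] [TopologicalSpace M]
    {f : A F → M} {s : M} (hf : f 0 = 0) (hs : HasSum f s) :
    HasSum (fun p : {a : A F // a.Monic} × Fˣ => f (C (p.2 : F) * p.1.1)) s := by
  have hinj : Function.Injective fun p : {a : A F // a.Monic} × Fˣ => C (p.2 : F) * p.1.1 := by
    rintro ⟨⟨a, ha⟩, u⟩ ⟨⟨b, hb⟩, v⟩ (hab : C (u : F) * a = C (v : F) * b)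
    obtain rfl : u = v := Units.ext <| by
      simpa [leadingCoeff_mul, ha.leadingCoeff, hb.leadingCoeff] using congrArg leadingCoeff hab
    obtain rfl : a = b := mul_left_cancel₀ (by simp) hab
    rfl
  refine (hinj.hasSum_iff fun a ha => ?_).2 hs
  rcases eq_or_ne a 0 with rfl | h0
  · exact hf
  · have hlead : a.leadingCoeff ≠ 0 := leadingCoeff_ne_zero.2 h0
    refine absurd ⟨⟨⟨a * C a.leadingCoeff⁻¹, monic_mul_leadingCoeff_inv h0⟩,
      Units.mk0 _ hlead⟩, ?_⟩ ha
    simp only [Units.val_mk0]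
    rw [mul_left_comm, ← C_mul, mul_inv_cancel₀ hlead, C_1, mul_one]

end PolynomialsOverFiniteField

section NormOnPolynomials

variable {F : Type*} [Field F] [Finite F]

theorem ofA_injective : Function.Injective (ofA (F := F)) :=
  (ofK (F := F)).injective.comp (FaithfulSMul.algebraMap_injective (A F) (K F))

theorem ofA_ne_zero {a : A F} (ha : a ≠ 0) : ofA a ≠ 0 :=
  (map_ne_zero_iff _ ofA_injective).2 ha

theorem norm_ofA_C_le (e : F) : ‖ofA (C e)‖ ≤ 1 := by
  rcases eq_or_ne e 0 with rfl | he
  · simp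
  · rw [norm_ofA (C_ne_zero.2 he), natDegree_C, pow_zero]

theorem norm_ofA_le_X_mul_add (b : A F) (e : F) : ‖ofA b‖ ≤ ‖ofA (X * b + C e)‖ := by
  rcases eq_or_ne b 0 with rfl | hb
  · simp
  · have hdeg : (X * b + C e).natDegree = b.natDegree + 1 := by
      rw [natDegree_add_C, natDegree_X_mul hb]
    have hne : X * b + C e ≠ 0 := fun h => by simp [h] at hdeg
    rw [norm_ofA hb, norm_ofA hne, hdeg]
    exact pow_le_pow_right₀ (one_lt_card F).le (Nat.le_succ _)

theorem tendsto_norm_ofA : Tendsto (fun a : A F => ‖ofA a‖) cofinite atTop := by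
  refine tendsto_atTop.2 fun R => eventually_cofinite.2 ?_
  obtain ⟨n, hn⟩ := pow_unbounded_of_one_lt R (one_lt_card F)
  refine (polysDegreeLT F n).finite_toSet.subset fun a ha => mem_polysDegreeLT.2 ?_
  rcases eq_or_ne a 0 with rfl | h0
  · simp
  · rw [← natDegree_lt_iff_degree_lt h0]
    have ha : ‖ofA a‖ < R := not_le.1 ha
    rw [norm_ofA h0] at ha
    exact (pow_lt_pow_iff_right₀ (one_lt_card F)).1 (ha.trans hn)

theorem tendsto_max_norm_ofA :
    Tendsto (fun p : A F × A F => max ‖ofA p.1‖ ‖ofA p.2‖) cofinite atTop := by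
  refine tendsto_atTop.2 fun R => eventually_cofinite.2 ?_
  have hfin := eventually_cofinite.1 (tendsto_norm_ofA (F := F) |>.eventually_ge_atTop R)
  exact (hfin.prod hfin).subset fun p hp =>
    ⟨fun h => hp (le_max_of_le_left h), fun h => hp (le_max_of_le_right h)⟩

theorem ofA_mul_add_ofA_ne_zero (z : Omega F) {a b : A F} (hab : a ≠ 0 ∨ b ≠ 0) :
    ofA a * (z : CInf F) + ofA b ≠ 0 := fun h => by
  obtain ⟨ha, hb⟩ := eq_zero_of_mul_add_eq_zero z h
  simp_all

theorem inv_norm_ofA_mul_add_le {n : ℕ} {z : Omega F} (hz : z ∈ affinoid F n) (a b : A F) :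
    ‖ofA a * (z : CInf F) + ofA b‖⁻¹ ≤
      (Nat.card F : ℝ) ^ (2 * n) * (max ‖ofA a‖ ‖ofA b‖)⁻¹ := by
  by_cases hab : a ≠ 0 ∨ b ≠ 0
  · have hmax : 0 < max ‖ofA a‖ ‖ofA b‖ := by
      simpa only [lt_max_iff, norm_pos_iff, map_ne_zero_iff _ ofA_injective] using hab
    rw [← div_eq_mul_inv, le_div_iff₀ hmax,
      inv_mul_le_iff₀ (norm_pos_iff.2 (ofA_mul_add_ofA_ne_zero z hab)), mul_comm]
    simpa only [norm_algebraMap', ofA, ofK, RingHom.comp_apply] using max_norm_le_of_mem_affinoid hz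
      (algebraMap (K F) (KInf F) (algebraMap (A F) (K F) a))
      (algebraMap (K F) (KInf F) (algebraMap (A F) (K F) b))
  · obtain ⟨rfl, rfl⟩ : a = 0 ∧ b = 0 := by simpa using hab
    simp

end NormOnPolynomials

section LowerUnipotent

/-- The matrix `(1 0; c 1)`. -/
def lowerUnipotent {R : Type*} [CommRing R] (c : R) : GL (Fin 2) R where
  val := !![1, 0; c, 1]
  inv := !![1, 0; -c, 1]
  val_inv := by simp [Matrix.one_fin_two]
  inv_val := by simp [Matrix.one_fin_two]

variable {F : Type*} [Field F] [Finite F]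

theorem den_lowerUnipotent (c : A F) (z : Omega F) :
    den (lowerUnipotent (algebraMap (A F) (K F) c)) z = ofA c * z + 1 := by
  simp [den, lowerUnipotent, ofA]

theorem moebius_lowerUnipotent_mul (c : A F) (z : Omega F) :
    (moebius (lowerUnipotent (algebraMap (A F) (K F) c)) z : CInf F) * (ofA c * z + 1) = z := by
  rw [← den_lowerUnipotent, moebius, div_mul_cancel₀ _ (den_ne_zero _ z)]
  simp [num, lowerUnipotent]

theorem det_lowerUnipotent {R : Type*} [CommRing R] (c : R) : (lowerUnipotent c).det = 1 := by
  ext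
  simp [lowerUnipotent, Matrix.det_fin_two]

end LowerUnipotent

section FalseEisenstein

variable {F : Type*} [Field F] [Finite F]

attribute [local instance] Fintype.ofFinite

/-- The terms of the false Eisenstein series. -/
def eisTerm (a b : A F) (z : Omega F) : CInf F := ofA a / (ofA a * z + ofA b)

/-- The sum of the terms of the false Eisenstein series over a coset of the constants. Unlike the
terms, these sums tend to zero, so they can be summed in any order. -/
def eisBlock (p : A F × A F) (z : Omega F) : CInf F := ∑ e : F, eisTerm p.1 (X * p.2 + C e) z

theorem norm_eisTerm_le {n : ℕ} {z : Omega F} (hz : z ∈ affinoid F n) (a b : A F) :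
    ‖eisTerm a b z‖ ≤ ‖ofA a‖ * ((Nat.card F : ℝ) ^ (2 * n) * (max ‖ofA a‖ ‖ofA b‖)⁻¹) := by
  rw [eisTerm, norm_div, div_eq_mul_inv]
  gcongr
  exact inv_norm_ofA_mul_add_le hz a b

-- Subtracting `a / (a z + X b)` from each of the `q` terms does not change their sum.
theorem eisBlock_eq_sum {a : A F} (ha : a ≠ 0) (b : A F) (z : Omega F) :
    eisBlock (a, b) z = ∑ e : F, -(ofA a * ofA (C e) *
      (ofA a * (z : CInf F) + ofA (X * b + C 0))⁻¹ *
      (ofA a * (z : CInf F) + ofA (X * b + C e))⁻¹) := by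
  have hne (b : A F) : ofA a * (z : CInf F) + ofA b ≠ 0 := ofA_mul_add_ofA_ne_zero z (.inl ha)
  calc eisBlock (a, b) z =
        ∑ e : F, (eisTerm a (X * b + C e) z - eisTerm a (X * b + C 0) z) := by
        rw [Finset.sum_sub_distrib, Finset.sum_const, Finset.card_univ, nsmul_eq_mul,
          ← Nat.card_eq_fintype_card, card_eq_zero, zero_mul, sub_zero, eisBlock]
    _ = _ := by
      refine Finset.sum_congr rfl fun e _ => ?_
      rw [eisTerm, eisTerm, div_sub_div _ _ (hne _) (hne _), ← neg_mul, ← neg_mul, mul_assoc,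
        ← mul_inv_rev, ← div_eq_mul_inv]
      simp only [map_add, map_zero]
      congr 1
      ring

theorem norm_eisBlock_le {n : ℕ} {z : Omega F} (hz : z ∈ affinoid F n) (p : A F × A F) :
    ‖eisBlock p z‖ ≤ ((Nat.card F : ℝ) ^ (2 * n)) ^ 2 * (max ‖ofA p.1‖ ‖ofA p.2‖)⁻¹ := by
  obtain ⟨a, b⟩ := p
  rcases eq_or_ne a 0 with rfl | ha
  · simp only [eisBlock, eisTerm, map_zero, zero_div, Finset.sum_const_zero, norm_zero]
    positivity
  have hmax : 0 < max ‖ofA a‖ ‖ofA b‖ := lt_max_of_lt_left (norm_pos_iff.2 (ofA_ne_zero ha))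
  have hinv (e : F) : ‖ofA a * (z : CInf F) + ofA (X * b + C e)‖⁻¹ ≤
      (Nat.card F : ℝ) ^ (2 * n) * (max ‖ofA a‖ ‖ofA b‖)⁻¹ := by
    refine (inv_norm_ofA_mul_add_le hz a _).trans ?_
    gcongr
    exact norm_ofA_le_X_mul_add b e
  rw [eisBlock_eq_sum ha]
  refine IsUltrametricDist.norm_sum_le_of_forall_le_of_nonneg (by positivity) fun e _ => ?_
  rw [norm_neg, norm_mul, norm_mul, norm_mul, norm_inv, norm_inv]
  calc _ ≤ max ‖ofA a‖ ‖ofA b‖ * 1 * ((Nat.card F : ℝ) ^ (2 * n) * (max ‖ofA a‖ ‖ofA b‖)⁻¹) *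
        ((Nat.card F : ℝ) ^ (2 * n) * (max ‖ofA a‖ ‖ofA b‖)⁻¹) := by
        gcongr
        · exact le_max_left _ _
        · exact norm_ofA_C_le e
        · exact hinv 0
        · exact hinv e
    _ = _ := by field_simp

theorem tendsto_inv_max_norm_ofA (C : ℝ) :
    Tendsto (fun p : A F × A F => C * (max ‖ofA p.1‖ ‖ofA p.2‖)⁻¹) cofinite (𝓝 0) := by
  simpa using tendsto_max_norm_ofA.inv_tendsto_atTop.const_mul C

theorem summable_eisBlock (z : Omega F) : Summable fun p => eisBlock p z := by
  obtain ⟨n, hz⟩ := exists_mem_affinoid z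
  exact NonarchimedeanAddGroup.summable_of_tendsto_cofinite_zero
    (squeeze_zero_norm (norm_eisBlock_le hz) (tendsto_inv_max_norm_ofA _))

theorem summable_eisTerm (a : A F) (z : Omega F) : Summable fun b => eisTerm a b z := by
  obtain ⟨n, hz⟩ := exists_mem_affinoid z
  refine NonarchimedeanAddGroup.summable_of_tendsto_cofinite_zero
    (squeeze_zero_norm (norm_eisTerm_le hz a) ?_)
  have hmax : Tendsto (fun b => max ‖ofA a‖ ‖ofA b‖) cofinite atTop :=
    tendsto_atTop_mono (fun b => le_max_right _ _) (tendsto_norm_ofA (F := F))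
  simpa using (hmax.inv_tendsto_atTop.const_mul _).const_mul ‖ofA a‖

theorem hasSum_tsum_eisTerm (z : Omega F) :
    HasSum (fun a => ∑' b, eisTerm a b z) (∑' p, eisBlock p z) := by
  refine (summable_eisBlock z).hasSum.prod_fiberwise fun a => ?_
  have h := (divXEquiv F).symm.hasSum_iff.2 (summable_eisTerm a z).hasSum
  exact h.prod_fiberwise fun b => hasSum_fintype _

theorem tsum_eisTerm_C_mul (u : Fˣ) (a : A F) (z : Omega F) :
    ∑' b, eisTerm (C (u : F) * a) b z = ∑' b, eisTerm a b z := by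
  rw [← (Units.mulLeft (u.map (C : F →+* A F))).tsum_eq]
  refine tsum_congr fun b => ?_
  simp only [eisTerm, Units.mulLeft_apply, Units.coe_map, MonoidHom.coe_coe, map_mul]
  rw [mul_assoc, ← mul_add, mul_div_mul_left _ _ (ofA_ne_zero (by simp))]

theorem falseE_eq_tsum_eisBlock (π : CInf F) (z : Omega F) :
    falseE π z = -π⁻¹ * ∑' p, eisBlock p z := by
  have hzero : ∑' b, eisTerm 0 b z = 0 := by simp [eisTerm]
  have hunits (a : {a : A F // a.Monic}) :
      HasSum (fun u : Fˣ => ∑' b, eisTerm (C (u : F) * a.1) b z) (-∑' b, eisTerm a.1 b z) := by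
    classical
    convert hasSum_fintype fun u : Fˣ => ∑' b, eisTerm (C (u : F) * a.1) b z
    simp only [tsum_eisTerm_C_mul, Finset.sum_const, Finset.card_univ, Fintype.card_units,
      nsmul_eq_mul]
    rw [← Nat.card_eq_fintype_card, Nat.cast_pred Nat.card_pos, card_eq_zero, zero_sub,
      neg_one_mul]
  have hmonic := ((hasSum_monic_prod_units hzero (hasSum_tsum_eisTerm z)).prod_fiberwise hunits).neg
  simp only [neg_neg] at hmonic
  rw [neg_mul, ← mul_neg, ← hmonic.tsum_eq]
  rfl

theorem isRigidAnalytic_eisTerm (a b : A F) : IsRigidAnalytic (eisTerm a b) := by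
  rcases eq_or_ne a 0 with rfl | ha
  · have hzero : eisTerm (0 : A F) b = 0 := funext fun z => by simp [eisTerm]
    exact hzero ▸ .zero
  · have heval (z : Omega F) : (C (ofA a) * X + C (ofA b) : (CInf F)[X]).eval (z : CInf F) =
        ofA a * z + ofA b := by
      simp only [eval_add, eval_mul, eval_C, eval_X]
    have hrat := IsRigidAnalytic.of_eval_div_eval (P := C (ofA a))
      (Q := C (ofA a) * X + C (ofA b)) fun z => by
        rw [heval]
        exact ofA_mul_add_ofA_ne_zero z (.inl ha)
    simp only [heval, eval_C] at hrat
    exact hrat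

theorem isRigidAnalytic_falseE (π : CInf F) : IsRigidAnalytic (falseE π) := by
  have hblock (p : A F × A F) : IsRigidAnalytic (eisBlock p) := by
    have hsum := IsRigidAnalytic.sum Finset.univ fun e _ =>
      isRigidAnalytic_eisTerm p.1 (X * p.2 + C e)
    exact (funext fun z => (Finset.sum_apply z _ _).symm : eisBlock p = _) ▸ hsum
  have htsum := IsRigidAnalytic.tsum hblock (fun n => tendsto_inv_max_norm_ofA _)
    fun n z hz => norm_eisBlock_le hz
  exact (funext (falseE_eq_tsum_eisBlock π) : falseE π = _) ▸ htsum.const_smul (-π⁻¹)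

theorem eisTerm_moebius_lowerUnipotent (c : A F) (z : Omega F) {a b : A F} (hab : a ≠ 0 ∨ b ≠ 0) :
    eisTerm (a - c * b) b (moebius (lowerUnipotent (algebraMap _ _ c)) z) =
      (ofA c * (z : CInf F) + 1) ^ 2 * eisTerm a b z - ofA c * (ofA c * (z : CInf F) + 1) := by
  have hJ := den_ne_zero (lowerUnipotent (algebraMap (A F) (K F) c)) z
  rw [den_lowerUnipotent] at hJ
  have hne := ofA_mul_add_ofA_ne_zero z hab
  set z₁ := moebius (lowerUnipotent (algebraMap (A F) (K F) c)) z
  have hden : (ofA (a - c * b) * (z₁ : CInf F) + ofA b) * (ofA c * (z : CInf F) + 1) =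
      ofA a * (z : CInf F) + ofA b := by
    rw [map_sub, map_mul, add_mul, mul_assoc, moebius_lowerUnipotent_mul]
    ring
  rw [eisTerm, eisTerm, ← mul_div_mul_right _ _ hJ, hden, map_sub, map_mul]
  field_simp
  ring

theorem sum_polysDegreeLT_prod_sub_mul {M : Type*} [AddCommMonoid M] (c : A F) (n : ℕ)
    (f : A F × A F → M) :
    ∑ p ∈ polysDegreeLT F (n + (c.natDegree + 1)) ×ˢ polysDegreeLT F (n + 1),
        f (p.1 - c * p.2, p.2) =
      ∑ p ∈ polysDegreeLT F (n + (c.natDegree + 1)) ×ˢ polysDegreeLT F (n + 1), f p := by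
  have hmul {b : A F} (hb : b ∈ polysDegreeLT F (n + 1)) :
      (c * b).degree < ↑(n + (c.natDegree + 1)) := by
    rw [mem_polysDegreeLT] at hb
    rcases eq_or_ne b 0 with rfl | hb0
    · simp
    · rw [← natDegree_lt_iff_degree_lt hb0] at hb
      refine degree_le_natDegree.trans_lt (Nat.cast_lt.2 (natDegree_mul_le.trans_lt (by lia)))
  refine Finset.sum_bij' (fun p _ => (p.1 - c * p.2, p.2)) (fun p _ => (p.1 + c * p.2, p.2))
    (fun p hp => ?_) (fun p hp => ?_) (fun p _ => by simp) (fun p _ => by simp) fun p _ => rfl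
  all_goals
    obtain ⟨ha, hb⟩ := Finset.mem_product.1 hp
    refine Finset.mem_product.2 ⟨mem_polysDegreeLT.2 ?_, hb⟩
  · exact (degree_sub_le _ _).trans_lt (max_lt (mem_polysDegreeLT.1 ha) (hmul hb))
  · exact (degree_add_le _ _).trans_lt (max_lt (mem_polysDegreeLT.1 ha) (hmul hb))

theorem sum_eisTerm_moebius_lowerUnipotent (c : A F) (z : Omega F) (n : ℕ) :
    ∑ p ∈ polysDegreeLT F (n + (c.natDegree + 1)) ×ˢ polysDegreeLT F (n + 1),
        eisTerm p.1 p.2 (moebius (lowerUnipotent (algebraMap _ _ c)) z) =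
      (ofA c * (z : CInf F) + 1) ^ 2 *
        ∑ p ∈ polysDegreeLT F (n + (c.natDegree + 1)) ×ˢ polysDegreeLT F (n + 1),
          eisTerm p.1 p.2 z +
      ofA c * (ofA c * (z : CInf F) + 1) := by
  classical
  set J := ofA c * (z : CInf F) + 1
  set W := polysDegreeLT F (n + (c.natDegree + 1)) ×ˢ polysDegreeLT F (n + 1) with hW
  set w := moebius (lowerUnipotent (algebraMap _ _ c)) z
  have h0W : 0 ∈ W := by simp [hW, mem_polysDegreeLT]
  have hcard : ((W.erase 0).card : CInf F) = -1 := by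
    rw [Finset.card_erase_of_mem h0W, Nat.cast_pred (Finset.card_pos.2 ⟨_, h0W⟩), hW,
      Finset.card_product, card_polysDegreeLT, card_polysDegreeLT, Nat.cast_mul, Nat.cast_pow,
      Nat.cast_pow, card_eq_zero, zero_pow n.succ_ne_zero, mul_zero, zero_sub]
  calc ∑ p ∈ W, eisTerm p.1 p.2 w
      = ∑ p ∈ W, eisTerm (p.1 - c * p.2) p.2 w :=
        (sum_polysDegreeLT_prod_sub_mul c n fun p => eisTerm p.1 p.2 w).symm
    _ = ∑ p ∈ W.erase 0, eisTerm (p.1 - c * p.2) p.2 w :=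
        (Finset.sum_erase W (by simp [eisTerm])).symm
    _ = ∑ p ∈ W.erase 0, (J ^ 2 * eisTerm p.1 p.2 z - ofA c * J) := by
        refine Finset.sum_congr rfl fun p hp => eisTerm_moebius_lowerUnipotent c z ?_
        by_contra! h
        exact Finset.ne_of_mem_erase hp (Prod.ext h.1 h.2)
    _ = J ^ 2 * ∑ p ∈ W.erase 0, eisTerm p.1 p.2 z + ofA c * J := by
        rw [Finset.sum_sub_distrib, ← Finset.mul_sum, Finset.sum_const, nsmul_eq_mul, hcard,
          neg_one_mul, sub_neg_eq_add]
    _ = J ^ 2 * ∑ p ∈ W, eisTerm p.1 p.2 z + ofA c * J := by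
        rw [Finset.sum_erase W (by simp [eisTerm])]

theorem tendsto_sum_eisTerm (c : A F) (z : Omega F) :
    Tendsto (fun n => ∑ p ∈ polysDegreeLT F (n + (c.natDegree + 1)) ×ˢ polysDegreeLT F (n + 1),
      eisTerm p.1 p.2 z) atTop (𝓝 (∑' p, eisBlock p z)) := by
  refine ((summable_eisBlock z).hasSum.comp
    (tendsto_polysDegreeLT_prod (c.natDegree + 1))).congr fun n => ?_
  rw [Function.comp_apply, Finset.sum_product, Finset.sum_product]
  refine Finset.sum_congr rfl fun a _ => ?_
  rw [sum_polysDegreeLT_succ]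
  rfl

theorem tsum_eisBlock_moebius_lowerUnipotent (c : A F) (z : Omega F) :
    ∑' p, eisBlock p (moebius (lowerUnipotent (algebraMap _ _ c)) z) =
      (ofA c * (z : CInf F) + 1) ^ 2 * ∑' p, eisBlock p z +
        ofA c * (ofA c * (z : CInf F) + 1) := by
  refine tendsto_nhds_unique (tendsto_sum_eisTerm c _) ?_
  simp only [sum_eisTerm_moebius_lowerUnipotent]
  exact ((tendsto_sum_eisTerm c z).const_mul _).add_const _

theorem slash_falseE_lowerUnipotent (π : CInf F) (c : A F) :
    slash 2 1 (falseE π) (lowerUnipotent (algebraMap (A F) (K F) c)) =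
      falseE π + -π⁻¹ • fun z => ofK (lowerUnipotent (algebraMap (A F) (K F) c) 1 0) /
        den (lowerUnipotent (algebraMap (A F) (K F) c)) z := by
  ext z
  have hJ := den_ne_zero (lowerUnipotent (algebraMap (A F) (K F) c)) z
  rw [Pi.add_apply, Pi.smul_apply, smul_eq_mul, slash, det_lowerUnipotent, Units.val_one, map_one,
    zpow_one, one_mul, zpow_neg, zpow_ofNat, falseE_eq_tsum_eisBlock, falseE_eq_tsum_eisBlock,
    tsum_eisBlock_moebius_lowerUnipotent,
    show ofK (lowerUnipotent (algebraMap (A F) (K F) c) 1 0) = ofA c from rfl]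
  rw [den_lowerUnipotent] at hJ ⊢
  field_simp
  ring

end FalseEisenstein

section AssociatedPolynomial

variable {F : Type*} [Field F] {Γ : Subgroup (GL (Fin 2) (K F))}

/-- The set of `c ∈ A` such that `(1 0; c 1) ∈ Γ`. -/
def lowerUnipotents (Γ : Subgroup (GL (Fin 2) (K F))) : Set (A F) :=
  {c | lowerUnipotent (algebraMap (A F) (K F) c) ∈ Γ}

theorem subset_lowerUnipotents_principal (𝔪 : Ideal (A F)) :
    (𝔪 : Set (A F)) ⊆ lowerUnipotents (principal 𝔪) := by
  intro c hc
  refine ⟨lowerUnipotent c, MonoidHom.mem_ker.2 ?_, ?_⟩ <;>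
  · ext i j
    fin_cases i <;> fin_cases j <;> simp [lowerUnipotent, Ideal.Quotient.eq_zero_iff_mem.2 hc]

theorem IsCongruence.infinite_lowerUnipotents (hΓ : IsCongruence Γ) :
    (lowerUnipotents Γ).Infinite := by
  obtain ⟨-, 𝔪, h𝔪, hle⟩ := hΓ
  obtain ⟨μ, hμ, hμ0⟩ := Submodule.exists_mem_ne_zero_of_ne_bot h𝔪
  exact Set.infinite_of_injective_forall_mem (mul_left_injective₀ hμ0) fun a =>
    hle (subset_lowerUnipotents_principal 𝔪 (𝔪.mul_mem_left a hμ))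

variable [Finite F] {k m : ℤ} {f g : Omega F → CInf F}

theorem injective_ofK_div_den_lowerUnipotent (z : Omega F) :
    Function.Injective fun c : A F => ofK (lowerUnipotent (algebraMap (A F) (K F) c) 1 0) /
      den (lowerUnipotent (algebraMap (A F) (K F) c)) z := by
  intro c d (h : ofA c / _ = ofA d / _)
  rw [div_eq_div_iff (den_ne_zero _ z) (den_ne_zero _ z), den_lowerUnipotent,
    den_lowerUnipotent] at h
  exact ofA_injective (by linear_combination h)

theorem eq_of_eval₂_eq (hΓ : (lowerUnipotents Γ).Infinite) {P Q : (Omega F → CInf F)[X]}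
    (h : ∀ c ∈ lowerUnipotents Γ, ∀ z : Omega F,
      P.eval₂ (Pi.evalRingHom _ z) (ofK (lowerUnipotent (algebraMap (A F) (K F) c) 1 0) /
          den (lowerUnipotent (algebraMap (A F) (K F) c)) z) =
        Q.eval₂ (Pi.evalRingHom _ z) (ofK (lowerUnipotent (algebraMap (A F) (K F) c) 1 0) /
          den (lowerUnipotent (algebraMap (A F) (K F) c)) z)) : P = Q := by
  have hmap (z : Omega F) : P.map (Pi.evalRingHom _ z) = Q.map (Pi.evalRingHom _ z) := by
    refine eq_of_infinite_eval_eq _ _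
      ((hΓ.image (injective_ofK_div_den_lowerUnipotent z).injOn).mono ?_)
    rintro _ ⟨c, hc, rfl⟩
    rw [Set.mem_ofPred_eq, eval_map, eval_map]
    exact h c hc z
  ext i z
  simpa only [coeff_map, Pi.evalRingHom_apply] using congrArg (coeff · i) (hmap z)

theorem isAssocPoly_iff_eq (hΓ : (lowerUnipotents Γ).Infinite)
    (hf : ∃ P, IsAssocPoly Γ k m f P) {Q : (Omega F → CInf F)[X]}
    (hQ : ∀ c ∈ lowerUnipotents Γ, ∀ z : Omega F,
      slash k m f (lowerUnipotent (algebraMap (A F) (K F) c)) z =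
        Q.eval₂ (Pi.evalRingHom _ z) (ofK (lowerUnipotent (algebraMap (A F) (K F) c) 1 0) /
          den (lowerUnipotent (algebraMap (A F) (K F) c)) z))
    (P : (Omega F → CInf F)[X]) : IsAssocPoly Γ k m f P ↔ P = Q := by
  have eq_of_isAssocPoly {P} (hP : IsAssocPoly Γ k m f P) : P = Q := by
    refine eq_of_eval₂_eq hΓ fun c hc z => ?_
    rw [← hQ c hc, hP.2 _ hc, eval₂_eq_sum_range]
    rfl
  obtain ⟨P₀, hP₀⟩ := hf
  exact ⟨eq_of_isAssocPoly, fun h => h ▸ eq_of_isAssocPoly hP₀ ▸ hP₀⟩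

/-- `f` is weakly modular of weight `k` and type `m` for `Γ`: rigid analytic and `Γ`-invariant
under the slash operator, with no periodicity or growth condition. -/
def IsWeaklyModular (Γ : Subgroup (GL (Fin 2) (K F))) (k m : ℤ) (f : Omega F → CInf F) : Prop :=
  IsRigidAnalytic f ∧ ∀ γ ∈ Γ, slash k m f γ = f

theorem slash_one (k m : ℤ) (f : Omega F → CInf F) : slash k m f 1 = f := by
  ext z
  have hmoebius : moebius (1 : GL (Fin 2) (K F)) z = z := by
    ext
    simp [moebius, num, den]
  simp [slash, hmoebius, den]

theorem IsModularForm.isWeaklyModular (hf : IsModularForm Γ k m f) : IsWeaklyModular Γ k m f := by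
  obtain ⟨hrigid, P, hdeg, hP, -⟩ := hf
  have hslash {γ : GL (Fin 2) (K F)} (hγ : γ ∈ Γ) : slash k m f γ = P.coeff 0 := by
    ext z
    rw [hP.2 γ hγ, Nat.le_zero.1 hdeg, zero_add, Finset.sum_range_one, pow_zero, mul_one]
  exact ⟨hrigid, fun γ hγ => by rw [hslash hγ, ← hslash Γ.one_mem, slash_one]⟩

theorem slash_add (k m : ℤ) (f g : Omega F → CInf F) (γ : GL (Fin 2) (K F)) :
    slash k m (f + g) γ = slash k m f γ + slash k m g γ :=
  funext fun _ => mul_add _ _ _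

theorem slash_const_smul (k m : ℤ) (a : CInf F) (f : Omega F → CInf F) (γ : GL (Fin 2) (K F)) :
    slash k m (a • f) γ = a • slash k m f γ :=
  funext fun _ => mul_left_comm _ _ _

theorem slash_sum {ι : Type*} (k m : ℤ) (s : Finset ι) (f : ι → Omega F → CInf F)
    (γ : GL (Fin 2) (K F)) : slash k m (∑ i ∈ s, f i) γ = ∑ i ∈ s, slash k m (f i) γ := by
  ext z
  simp only [slash, Finset.sum_apply, Finset.mul_sum]

theorem sum_range_sum_range_succ_eq {M : Type*} [AddCommMonoid M] (n : ℕ) (f : ℕ → ℕ → M) :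
    ∑ h ∈ Finset.range (n + 1), ∑ j ∈ Finset.range (h + 1), f h j =
      ∑ j ∈ Finset.range (n + 1), ∑ h ∈ Finset.Icc j n, f h j :=
  Finset.sum_comm' fun h j => by
    simp only [Finset.mem_range, Finset.mem_Icc]
    lia

theorem IsWeaklyModular.slash_normDeriv {π : CInf F} {k h : ℕ} (hk : 2 * h < k)
    (hg : IsWeaklyModular Γ (k - 2 * h) (m - h) g) {γ : GL (Fin 2) (K F)} (hγ : γ ∈ Γ)
    (z : Omega F) :
    slash k m (normDeriv π h g) γ z = ∑ j ∈ Finset.range (h + 1), ((-π) ^ j)⁻¹ *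
      ((Nat.choose (k - h - 1) j : CInf F) * normDeriv π (h - j) g z) *
        (ofK (γ 1 0) / den γ z) ^ j := by
  obtain ⟨M, rfl⟩ := Nat.exists_eq_add_of_lt hk
  have hweight : ((2 * h + M + 1 : ℕ) : ℤ) - 2 * h = M + 1 := by
    push_cast
    ring
  have hslash := slash_normDeriv_of_slash_eq (π := π) hg.1 (hweight ▸ hg.2 γ hγ) h z
  rw [sub_add_cancel, show (M : ℤ) + 1 + 2 * h = (2 * h + M + 1 : ℕ) by push_cast; ring] at hslash
  rw [hslash, show 2 * h + M + 1 - h - 1 = M + h by lia]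
  simp only [mul_assoc]

theorem slash_sum_normDeriv {π : CInf F} {k n : ℕ} (hk : 2 * n < k) {fD : ℕ → Omega F → CInf F}
    (hfD : ∀ i ≤ n, IsWeaklyModular Γ (k - 2 * i) (m - i) (fD i)) {γ : GL (Fin 2) (K F)}
    (hγ : γ ∈ Γ) (z : Omega F) :
    slash k m (∑ i ∈ Finset.range (n + 1), normDeriv π i (fD i)) γ z =
      ∑ j ∈ Finset.range (n + 1), ((-π) ^ j)⁻¹ * (∑ h ∈ Finset.Icc j n,
        (Nat.choose (k - h - 1) j : CInf F) * normDeriv π (h - j) (fD h) z) *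
          (ofK (γ 1 0) / den γ z) ^ j := by
  simp only [slash_sum, Finset.sum_apply, Finset.mul_sum, Finset.sum_mul]
  rw [← sum_range_sum_range_succ_eq]
  refine Finset.sum_congr rfl fun h hh => ?_
  have hhn : h ≤ n := Finset.mem_range_succ_iff.1 hh
  exact (hfD h hhn).slash_normDeriv (by lia) hγ z

theorem slash_lowerUnipotent_congr (k m m' : ℤ) (f : Omega F → CInf F) (c : K F) :
    slash k m f (lowerUnipotent c) = slash k m' f (lowerUnipotent c) := by
  ext z
  simp only [slash, det_lowerUnipotent, Units.val_one, map_one, one_zpow]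

theorem slash_normDeriv_falseE {π : CInf F} (hπ : π ≠ 0) (n : ℕ) (m : ℤ) (c : A F) (z : Omega F) :
    slash (2 * (n + 1) : ℕ) m (normDeriv π n (falseE π))
        (lowerUnipotent (algebraMap (A F) (K F) c)) z =
      ∑ j ∈ Finset.range (n + 1), ((-π) ^ j)⁻¹ * (n + 1).choose j *
        normDeriv π (n - j) (falseE π) z *
          (ofK (lowerUnipotent (algebraMap (A F) (K F) c) 1 0) /
            den (lowerUnipotent (algebraMap (A F) (K F) c)) z) ^ j +
      ((-π) ^ (n + 1))⁻¹ * (ofK (lowerUnipotent (algebraMap (A F) (K F) c) 1 0) /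
        den (lowerUnipotent (algebraMap (A F) (K F) c)) z) ^ (n + 1) := by
  have hweight : ((2 * (n + 1) : ℕ) : ℤ) = 2 + 2 * n := by
    push_cast
    ring
  rw [hweight, slash_lowerUnipotent_congr _ m (1 + n)]
  exact slash_normDeriv_of_slash_eq_sub hπ (isRigidAnalytic_falseE π)
    (slash_falseE_lowerUnipotent π c) n z

end AssociatedPolynomial

end Drinfeld

end

theorem theorem4p8_general {F : Type*} [Field F] [Finite F]
    (π : Drinfeld.CInf F) (hπ : Drinfeld.IsCarlitzPeriod π)
    (Γ : Subgroup (GL (Fin 2) (Drinfeld.K F))) (hΓ : (Drinfeld.lowerUnipotents Γ).Infinite)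
    (k ℓ : ℕ) (m : ℤ) (hℓ : 1 ≤ ℓ) (f : Drinfeld.Omega F → Drinfeld.CInf F)
    (hf : ∃ P, Drinfeld.IsAssocPoly Γ k m f P)
    (fD : ℕ → Drinfeld.Omega F → Drinfeld.CInf F) :
    (2 * ℓ < k →
      (∀ i ≤ ℓ, Drinfeld.IsWeaklyModular Γ (k - 2 * i) (m - i) (fD i)) →
      f = ∑ i ∈ Finset.range (ℓ + 1), Drinfeld.normDeriv π i (fD i) →
      ∀ P : (Drinfeld.Omega F → Drinfeld.CInf F)[X],
        Drinfeld.IsAssocPoly Γ k m f P ↔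
          P = ∑ j ∈ Finset.range (ℓ + 1), monomial j
            (((-π) ^ j)⁻¹ • ∑ h ∈ Finset.Icc j ℓ,
              (Nat.choose (k - h - 1) j : Drinfeld.CInf F) •
                Drinfeld.normDeriv π (h - j) (fD h))) ∧
    (k = 2 * ℓ → ∀ α : Drinfeld.CInf F,
      (∀ i < ℓ, Drinfeld.IsWeaklyModular Γ (k - 2 * i) (m - i) (fD i)) →
      f = α • Drinfeld.normDeriv π (ℓ - 1) (Drinfeld.falseE π) +
        ∑ i ∈ Finset.range ℓ, Drinfeld.normDeriv π i (fD i) →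
      ∀ P : (Drinfeld.Omega F → Drinfeld.CInf F)[X],
        Drinfeld.IsAssocPoly Γ k m f P ↔
          P = monomial ℓ (fun _ => α * ((-π) ^ ℓ)⁻¹) +
            ∑ j ∈ Finset.range ℓ, monomial j
              (((-π) ^ j)⁻¹ •
                ((α * (Nat.choose ℓ j : Drinfeld.CInf F)) •
                    Drinfeld.normDeriv π (ℓ - j - 1) (Drinfeld.falseE π) +
                  ∑ h ∈ Finset.Icc j (ℓ - 1),
                    (Nat.choose (2 * ℓ - h - 1) j : Drinfeld.CInf F) •
                      Drinfeld.normDeriv π (h - j) (fD h)))) := by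
  constructor
  · intro hk hfD hsum
    refine Drinfeld.isAssocPoly_iff_eq hΓ hf fun c hc z => ?_
    rw [hsum, Drinfeld.slash_sum_normDeriv hk hfD hc, eval₂_finsetSum]
    simp only [eval₂_monomial, Pi.evalRingHom_apply, Pi.smul_apply, Finset.sum_apply, smul_eq_mul]
  · rintro rfl α hfD hsum
    obtain ⟨n, rfl⟩ := Nat.exists_eq_add_of_le' hℓ
    refine Drinfeld.isAssocPoly_iff_eq hΓ hf fun c hc z => ?_
    have hE := Drinfeld.slash_normDeriv_falseE hπ.1 n m c z
    have hD := Drinfeld.slash_sum_normDeriv (π := π) (by lia)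
      (fun i hi => hfD i (Nat.lt_succ_of_le hi)) hc z
    rw [hsum, Drinfeld.slash_add, Drinfeld.slash_const_smul, Pi.add_apply, Pi.smul_apply, hD,
      Nat.add_sub_cancel, hE, smul_eq_mul, mul_add, eval₂_add, eval₂_finsetSum]
    simp only [eval₂_monomial, Pi.evalRingHom_apply, Pi.smul_apply, Pi.add_apply,
      Finset.sum_apply, smul_eq_mul]
    rw [add_right_comm, add_comm, mul_assoc, Finset.mul_sum, ← Finset.sum_add_distrib]
    congr! 2 with j
    rw [show n + 1 - j - 1 = n - j by lia]
    ring

theorem theorem4p8 {F : Type*} [Field F] [Finite F]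
    (π : Drinfeld.CInf F) (hπ : Drinfeld.IsCarlitzPeriod π)
    (Γ : Subgroup (GL (Fin 2) (Drinfeld.K F))) (hΓ : Drinfeld.IsCongruence Γ)
    (k ℓ : ℕ) (m : ℤ) (hℓ : 1 ≤ ℓ)
    (f : Drinfeld.Omega F → Drinfeld.CInf F)
    (hf : Drinfeld.IsQuasiModularForm Γ k m ℓ f)
    (fD : ℕ → Drinfeld.Omega F → Drinfeld.CInf F) :
    (2 * ℓ < k →
      (∀ i ≤ ℓ, Drinfeld.IsModularForm Γ (k - 2 * i) (m - i) (fD i)) →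
      f = ∑ i ∈ Finset.range (ℓ + 1), Drinfeld.normDeriv π i (fD i) →
      ∀ P : (Drinfeld.Omega F → Drinfeld.CInf F)[X],
        Drinfeld.IsAssocPoly Γ k m f P ↔
          P = ∑ j ∈ Finset.range (ℓ + 1), monomial j
            (((-π) ^ j)⁻¹ • ∑ h ∈ Finset.Icc j ℓ,
              (Nat.choose (k - h - 1) j : Drinfeld.CInf F) •
                Drinfeld.normDeriv π (h - j) (fD h))) ∧
    (k = 2 * ℓ → ∀ α : Drinfeld.CInf F,
      (∀ i < ℓ, Drinfeld.IsModularForm Γ (k - 2 * i) (m - i) (fD i)) →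
      f = α • Drinfeld.normDeriv π (ℓ - 1) (Drinfeld.falseE π) +
        ∑ i ∈ Finset.range ℓ, Drinfeld.normDeriv π i (fD i) →
      ∀ P : (Drinfeld.Omega F → Drinfeld.CInf F)[X],
        Drinfeld.IsAssocPoly Γ k m f P ↔
          P = monomial ℓ (fun _ => α * ((-π) ^ ℓ)⁻¹) +
            ∑ j ∈ Finset.range ℓ, monomial j
              (((-π) ^ j)⁻¹ •
                ((α * (Nat.choose ℓ j : Drinfeld.CInf F)) •
                    Drinfeld.normDeriv π (ℓ - j - 1) (Drinfeld.falseE π) +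
                  ∑ h ∈ Finset.Icc j (ℓ - 1),
                    (Nat.choose (2 * ℓ - h - 1) j : Drinfeld.CInf F) •
                      Drinfeld.normDeriv π (h - j) (fD h)))) :=
  have ⟨part₁, part₂⟩ := theorem4p8_general π hπ Γ hΓ.infinite_lowerUnipotents k ℓ m hℓ f
    (hf.2.imp fun _ hP => hP.2.1) fD
  ⟨fun hk hfD => part₁ hk fun i hi => (hfD i hi).isWeaklyModular,
    fun hk α hfD => part₂ hk α fun i hi => (hfD i hi).isWeaklyModular⟩
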